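/- Let $\pi:Y\to X$ be a fibered manifold (a smooth surjective submersion) with $\dim X=2$, $\dim Y=2+m$, let $J^rY$ be its $r$-th jet prolongation, and for a fibered chart $(V,\psi)$, $\psi=(x^i,y^\sigma)$, $1\le i\le 2$, $1\le\sigma\le m$, on $Y$ let $(V^r,\psi^r)$, $\psi^r=(x^i,y^\sigma,y^\sigma_{j},\dots,y^\sigma_{j_1\dots j_r})$, be the associated chart on $J^rY$. Repeated indices are summed over all their values, and $\partial/\partial y^\sigma_{ij}$ is the symmetrized partial derivative, $\partial y^\nu_{pq}/\partial y^\sigma_{ij}=\frac12\delta^\nu_\sigma(\delta^i_p\delta^j_q+\delta^i_q\delta^j_p)$ (so $\partial/\partial y^\sigma_{12}$ is one half of the ordinary derivative in the coordinate $y^\sigma_{12}=y^\sigma_{21}$). For a function $f$ on $V^r$ put $$d_if=\frac{\partial f}{\partial x^i}+\sum_{|J|\le r}y^\sigma_{Ji}\,\partial_{y^\sigma_J}f\quad(\text{on }V^{r+1}),\qquad d_i'f=\frac{\partial f}{\partial x^i}+\sum_{|J|\le r-1}y^\sigma_{Ji}\,\partial_{y^\sigma_J}f\quad(\text{on }V^r),$$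 where $J$ runs over the unordered multi-indices and $\partial_{y^\sigma_J}$ is the ordinary partial derivative in the coordinate $y^\sigma_J$. Put $\omega_0=dx^1\wedge dx^2$, $\omega_1=dx^2$, $\omega_2=-dx^1$, $\omega^\sigma=dy^\sigma-y^\sigma_i\,dx^i$, $\omega^\sigma_j=dy^\sigma_j-y^\sigma_{ji}\,dx^i$. Let $\lambda$ be a second-order Lagrangian, that is, a smooth $\pi^2$-horizontal $2$-form on $J^2Y$ (where $\pi^2:J^2Y\to X$ is the projection), $\lambda=\mathscr L\,\omega_0$ on $V^2$ in each fibered chart, and assume that in every fibered chart, for all indices, $$\frac{\partial^2\mathscr L}{\partial y^\nu_{pq}\partial y^\sigma_{ij}}+\frac{\partial^2\mathscr L}{\partial y^\nu_{ip}\partial y^\sigma_{qj}}+\frac{\partial^2\mathscr L}{\partial y^\nu_{qi}\partial y^\sigma_{pj}}=0 .$$ Call $\lambda$ variationally trivial if in every fibered chart $$\frac{\partial\mathscr L}{\partial y^\sigma}-d_i\frac{\partial\mathscr L}{\partial y^\sigma_i}+d_id_j\frac{\partial\mathscr L}{\partial y^\sigma_{ij}}=0\quad\text{on }V^4\text{ for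 all }\sigma.$$ In a fibered chart $(V,\psi)$ let $$\Theta_\lambda=\mathscr L\omega_0+\Big(\frac{\partial\mathscr L}{\partial y^\sigma_j}-d_i\frac{\partial\mathscr L}{\partial y^\sigma_{ij}}\Big)\omega^\sigma\wedge\omega_j+\frac{\partial\mathscr L}{\partial y^\sigma_{ij}}\,\omega^\sigma_i\wedge\omega_j,$$ and, for smooth functions $P_{\sigma\nu},Q^j_{\sigma,\nu},R^{i,j}_{\sigma,\nu}$ on $V^3$ with $P_{\sigma\nu}=-P_{\nu\sigma}$ and $R^{i,j}_{\sigma,\nu}=-R^{j,i}_{\nu,\sigma}$, let $$Z_\lambda=\Theta_\lambda+\tfrac12P_{\sigma\nu}\,\omega^\sigma\wedge\omega^\nu+Q^j_{\sigma,\nu}\,\omega^\sigma\wedge\omega^\nu_j+\tfrac12R^{i,j}_{\sigma,\nu}\,\omega^\sigma_i\wedge\omega^\nu_j .$$ Consider the functions of second order \begin{align*} P_{\sigma\nu}&=\tfrac12\Big(\tfrac{\partial^2\mathscr L}{\partial y^\sigma_1\partial y^\nu_2}-\tfrac{\partial^2\mathscr L}{\partial y^\nu_1\partial y^\sigma_2}\Big)+d_1'\Big(\tfrac{\partial^2\mathscr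 L}{\partial y^\nu_1\partial y^\sigma_{12}}-\tfrac{\partial^2\mathscr L}{\partial y^\sigma_1\partial y^\nu_{12}}\Big)+d_2'\Big(\tfrac{\partial^2\mathscr L}{\partial y^\sigma_2\partial y^\nu_{12}}-\tfrac{\partial^2\mathscr L}{\partial y^\nu_2\partial y^\sigma_{12}}\Big),\\ Q^1_{\sigma,\nu}&=2\tfrac{\partial^2\mathscr L}{\partial y^\sigma_1\partial y^\nu_{12}}-\tfrac{\partial^2\mathscr L}{\partial y^\nu_1\partial y^\sigma_{12}}-\tfrac{\partial^2\mathscr L}{\partial y^\nu_2\partial y^\sigma_{11}}-2d_2'\tfrac{\partial^2\mathscr L}{\partial y^\sigma_{12}\partial y^\nu_{12}},\\ Q^2_{\sigma,\nu}&=-2\tfrac{\partial^2\mathscr L}{\partial y^\sigma_2\partial y^\nu_{12}}+\tfrac{\partial^2\mathscr L}{\partial y^\nu_1\partial y^\sigma_{22}}+\tfrac{\partial^2\mathscr L}{\partial y^\nu_2\partial y^\sigma_{12}}+2d_1'\tfrac{\partial^2\mathscr L}{\partial y^\sigma_{12}\partial y^\nu_{12}},\\ R^{1,2}_{\sigma,\nu}&=-2\tfrac{\partial^2\mathscr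 L}{\partial y^\sigma_{12}\partial y^\nu_{12}}=-R^{2,1}_{\sigma,\nu},\qquad R^{1,1}_{\sigma,\nu}=R^{2,2}_{\sigma,\nu}=0.\tag{$*$} \end{align*} Then in every fibered chart the functions $(*)$ are smooth and satisfy the skew-symmetry conditions above, and if $\lambda$ is variationally trivial, then $Z_\lambda$ is closed on $V^3$ if and only if its coefficients $P_{\sigma\nu},Q^j_{\sigma,\nu},R^{i,j}_{\sigma,\nu}$ are given by $(*)$ on $V^3$. (The form $Z_\lambda$ with coefficients $(*)$ is called the fundamental Lepage equivalent of $\lambda$.) -/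

import Mathlib

open scoped Manifold ContDiff

noncomputable section

namespace FundLepage

/-! ### Fibered manifolds over a two-dimensional base, fibered charts, jets of sections

Base indices `1, 2` are represented by `0, 1 : Fin 2`. -/

section Geometry

variable {m : ℕ} {X Y : Type*}
  [TopologicalSpace X] [ChartedSpace (EuclideanSpace ℝ (Fin 2)) X]
  [TopologicalSpace Y] [ChartedSpace (EuclideanSpace ℝ (Fin (2 + m))) Y]

/-- `π : Y → X` is a smooth surjective submersion. -/
structure IsFibered (π : Y → X) : Prop where
  smooth : ContMDiff (𝓡 (2 + m)) (𝓡 2) ∞ π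
  surjective : Function.Surjective π
  submersion : ∀ y, Function.Surjective (mfderiv (𝓡 (2 + m)) (𝓡 2) π y)

/-- A fibered chart `(V, ψ)`, `ψ = (xⁱ, y^σ)`, on `Y`, with its associated chart `(π(V), φ)`,
`φ = (xⁱ)`, on `X`. -/
structure FiberedChart (π : Y → X) where
  ψ : OpenPartialHomeomorph Y ((Fin 2 → ℝ) × (Fin m → ℝ))
  φ : OpenPartialHomeomorph X (Fin 2 → ℝ)
  smooth_ψ : ContMDiffOn (𝓡 (2 + m)) 𝓘(ℝ, (Fin 2 → ℝ) × (Fin m → ℝ)) ∞ ψ ψ.source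
  smooth_ψ_symm : ContMDiffOn 𝓘(ℝ, (Fin 2 → ℝ) × (Fin m → ℝ)) (𝓡 (2 + m)) ∞ ψ.symm ψ.target
  smooth_φ : ContMDiffOn (𝓡 2) 𝓘(ℝ, Fin 2 → ℝ) ∞ φ φ.source
  smooth_φ_symm : ContMDiffOn 𝓘(ℝ, Fin 2 → ℝ) (𝓡 2) ∞ φ.symm φ.target
  source_φ : φ.source = π '' ψ.source
  fst_ψ : ∀ y ∈ ψ.source, (ψ y).1 = φ (π y)

/-- A smooth section `γ` of `π` over an open set `dom`, together with a point `base ∈ dom`. -/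
structure PointedSection (π : Y → X) where
  base : X
  dom : Set X
  isOpen_dom : IsOpen dom
  base_mem : base ∈ dom
  γ : X → Y
  smooth : ContMDiffOn (𝓡 2) (𝓡 (2 + m)) ∞ γ dom
  isSection : ∀ x ∈ dom, π (γ x) = x

/-- The components `y^σ ∘ γ ∘ φ⁻¹` of a section in a fibered chart. -/
def FiberedChart.rep {π : Y → X} (c : FiberedChart (m := m) π)
    (s : PointedSection (m := m) π) : (Fin 2 → ℝ) → (Fin m → ℝ) :=
  fun u => (c.ψ (s.γ (c.φ.symm u))).2

/-- Two pointed sections have the same `r`-jet: same source, same target, and in every fibered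
chart around the target all partial derivatives of the components up to order `r` agree. -/
def jetSetoid (π : Y → X) (r : ℕ) : Setoid (PointedSection (m := m) π) where
  r s t := s.base = t.base ∧ s.γ s.base = t.γ t.base ∧
    ∀ c : FiberedChart (m := m) π, s.γ s.base ∈ c.ψ.source → ∀ k ≤ r,
      iteratedFDeriv ℝ k (c.rep s) (c.φ s.base) = iteratedFDeriv ℝ k (c.rep t) (c.φ t.base)
  iseqv :=
    { refl := fun _ => ⟨rfl, rfl, fun _ _ _ _ => rfl⟩
      symm := fun h => ⟨h.1.symm, h.2.1.symm,
        fun c hc k hk => (h.2.2 c (h.2.1 ▸ hc) k hk).symm⟩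
      trans := fun h h' => ⟨h.1.trans h'.1, h.2.1.trans h'.2.1,
        fun c hc k hk => (h.2.2 c hc k hk).trans (h'.2.2 c (h.2.1 ▸ hc) k hk)⟩ }

/-- The set of points of the jet prolongation `Jʳ Y`: `r`-jets of local sections. -/
def Jet (m : ℕ) {X Y : Type*}
    [TopologicalSpace X] [ChartedSpace (EuclideanSpace ℝ (Fin 2)) X]
    [TopologicalSpace Y] [ChartedSpace (EuclideanSpace ℝ (Fin (2 + m))) Y]
    (π : Y → X) (r : ℕ) : Type _ :=
  Quotient (jetSetoid (m := m) π r)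

/-- The `r`-jet of `γ` at its base point. -/
def PointedSection.jet {π : Y → X} (s : PointedSection (m := m) π) (r : ℕ) : Jet m π r :=
  Quotient.mk (jetSetoid (m := m) π r) s

/-- The projection `Jʳ Y → X`. -/
def Jet.base {π : Y → X} {r : ℕ} (j : Jet m π r) : X :=
  Quotient.lift (s := jetSetoid (m := m) π r) (fun s : PointedSection (m := m) π => s.base)
    (fun _ _ h => And.left h) j

end Geometry

/-! ### Coordinates on jet prolongations, formal derivatives -/

/-- The space of the jet coordinates `(xⁱ, y^σ_J)`, `|J| ≤ r`. A multi-index `J = (j₁ ≤ … ≤ j_k)`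
over `{1, 2}` is encoded by its length `k` and the number `l ≤ k` of its entries equal to `2`;
`p.1 i` is `xⁱ` and `p.2 k l σ` is `y^σ_J`. -/
abbrev JetCoords (m r : ℕ) : Type :=
  (Fin 2 → ℝ) × ((k : Fin (r + 1)) → Fin ((k : ℕ) + 1) → Fin m → ℝ)

section Coordinates

variable {m r : ℕ}

/-- The canonical projection `J^{r+1} Y → J^r Y` in coordinates. -/
def proj (p : JetCoords m (r + 1)) : JetCoords m r :=
  (p.1, fun k l σ => p.2 k.castSucc l σ)

/-- The coordinate vector `∂/∂y^σ_J`, `J` of length `k` with `l` entries `2`. -/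
def vecY (k l : ℕ) (hk : k < r + 1) (hl : l < k + 1) (σ : Fin m) : JetCoords m r :=
  (0, Pi.single ⟨k, hk⟩ (Pi.single ⟨l, hl⟩ (Pi.single σ 1)))

/-- The vector `∂/∂xⁱ + ∑_{|J| ≤ r} y^σ_{Ji} ∂/∂y^σ_J` along `J^{r+1} Y → J^r Y`. -/
def formalVec (i : Fin 2) (p : JetCoords m (r + 1)) : JetCoords m r :=
  (Pi.single i 1, fun k l σ =>
    p.2 k.succ ⟨(l : ℕ) + (i : ℕ), by
      have h := l.isLt; have h' := i.isLt; simp only [Fin.val_succ]; omega⟩ σ)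

/-- The vector `∂/∂xⁱ + ∑_{|J| ≤ r - 1} y^σ_{Ji} ∂/∂y^σ_J` on `J^r Y`. -/
def cutVec (i : Fin 2) (p : JetCoords m r) : JetCoords m r :=
  (Pi.single i 1, fun k l σ =>
    if h : (k : ℕ) < r then
      p.2 ⟨(k : ℕ) + 1, by omega⟩ ⟨(l : ℕ) + (i : ℕ), by
        have h := l.isLt; have h' := i.isLt; simp only; omega⟩ σ
    else 0)

/-- The formal derivative `d_i`. -/
def formalD (i : Fin 2) (f : JetCoords m r → ℝ) : JetCoords m (r + 1) → ℝ :=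
  fun p => fderiv ℝ f (proj p) (formalVec i p)

/-- The cut formal derivative `d'_i`. -/
def cutD (i : Fin 2) (f : JetCoords m r → ℝ) : JetCoords m r → ℝ :=
  fun p => fderiv ℝ f p (cutVec i p)

/-- `∂f/∂y^σ` for a function of second order. -/
def dY (σ : Fin m) (f : JetCoords m 2 → ℝ) : JetCoords m 2 → ℝ :=
  fun p => fderiv ℝ f p (vecY 0 0 (by omega) (by omega) σ)

/-- `∂f/∂y^σ_j` for a function of second order. -/
def dY1 (j : Fin 2) (σ : Fin m) (f : JetCoords m 2 → ℝ) : JetCoords m 2 → ℝ :=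
  fun p => fderiv ℝ f p (vecY 1 j (by omega) (by omega) σ)

/-- `∂f/∂y^σ_{ij}` for a function of second order, with the usual convention for sums over all
`i, j`: `∂y^σ_{pq}/∂y^σ_{ij}` is the symmetrized Kronecker symbol, so that for `i ≠ j` this is one
half of the derivative in the coordinate `y^σ_{12}`. -/
def dY2 (i j : Fin 2) (σ : Fin m) (f : JetCoords m 2 → ℝ) : JetCoords m 2 → ℝ :=
  fun p => (if i = j then 1 else 1 / 2) *
    fderiv ℝ f p (vecY 2 ((i : ℕ) + (j : ℕ)) (by omega) (by omega) σ)

/-! ### Differential forms in jet coordinates -/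

/-- The 1-form `dxⁱ`. -/
def dx (i : Fin 2) : JetCoords m r →L[ℝ] ℝ :=
  (ContinuousLinearMap.proj i).comp (ContinuousLinearMap.fst ℝ _ _)

/-- The 1-form `dy^σ_J`. -/
def dyForm (k l : ℕ) (hk : k < r + 1) (hl : l < k + 1) (σ : Fin m) : JetCoords m r →L[ℝ] ℝ :=
  (ContinuousLinearMap.proj σ).comp
    ((ContinuousLinearMap.proj (R := ℝ) (φ := fun _ : Fin (k + 1) => Fin m → ℝ) ⟨l, hl⟩).comp
      ((ContinuousLinearMap.proj (R := ℝ)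
        (φ := fun k : Fin (r + 1) => Fin ((k : ℕ) + 1) → Fin m → ℝ) ⟨k, hk⟩).comp
        (ContinuousLinearMap.snd ℝ _ _)))

/-- The contact 1-form `ω^σ_J = dy^σ_J - y^σ_{Ji} dxⁱ`, `|J| ≤ r - 1`. -/
def contact (k l : ℕ) (hk : k < r) (hl : l < k + 1) (σ : Fin m) (p : JetCoords m r) :
    JetCoords m r →L[ℝ] ℝ :=
  dyForm k l (by omega) hl σ -
    ∑ i : Fin 2, p.2 ⟨k + 1, by omega⟩ ⟨l + (i : ℕ), by simp only; omega⟩ σ • dx i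

/-- The wedge product of two linear forms. -/
def wedge {E : Type*} [NormedAddCommGroup E] [NormedSpace ℝ E] (α β : E →L[ℝ] ℝ) :
    E [⋀^Fin 2]→L[ℝ] ℝ :=
  ContinuousMultilinearMap.alternatization
    ((ContinuousMultilinearMap.mkPiAlgebra ℝ (Fin 2) ℝ).compContinuousLinearMap ![α, β])

theorem wedge_apply {E : Type*} [NormedAddCommGroup E] [NormedSpace ℝ E] (α β : E →L[ℝ] ℝ)
    (v : Fin 2 → E) : wedge α β v = α (v 0) * β (v 1) - α (v 1) * β (v 0) := by
  have hu : (Finset.univ : Finset (Equiv.Perm (Fin 2))) = {1, Equiv.swap 0 1} := by decide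
  have hne : (1 : Equiv.Perm (Fin 2)) ≠ Equiv.swap 0 1 := by decide
  rw [wedge, ContinuousMultilinearMap.alternatization_apply_apply, hu, Finset.sum_pair hne]
  simp [Fin.prod_univ_two, sub_eq_add_neg]

/-- `ω_j = i_{∂/∂x^j} (dx¹ ∧ dx²)`, that is `ω_1 = dx²` and `ω_2 = -dx¹`. -/
def omegaBase (j : Fin 2) : JetCoords m r →L[ℝ] ℝ :=
  if j = 0 then dx 1 else -dx 0

/-- The contact form `ω^σ` on the third jet prolongation. -/
def om (σ : Fin m) (p : JetCoords m 3) : JetCoords m 3 →L[ℝ] ℝ :=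
  contact 0 0 (by omega) (by omega) σ p

/-- The contact form `ω^σ_j` on the third jet prolongation. -/
def om1 (j : Fin 2) (σ : Fin m) (p : JetCoords m 3) : JetCoords m 3 →L[ℝ] ℝ :=
  contact 1 j (by omega) (by omega) σ p

/-! ### Chart expressions attached to a second-order Lagrange function -/

/-- The order-reducibility condition at a point. -/
def OrderConditionAt (L : JetCoords m 2 → ℝ) (z : JetCoords m 2) : Prop :=
  ∀ (p q i j : Fin 2) (σ ν : Fin m),
    dY2 p q ν (dY2 i j σ L) z + dY2 i p ν (dY2 q j σ L) z + dY2 q i ν (dY2 p j σ L) z = 0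

/-- The Euler–Lagrange expressions `∂L/∂y^σ - d_i ∂L/∂y^σ_i + d_i d_j ∂L/∂y^σ_{ij}`. -/
def eulerLagrange (L : JetCoords m 2 → ℝ) (σ : Fin m) (z : JetCoords m 4) : ℝ :=
  dY σ L (proj (proj z)) - ∑ i : Fin 2, formalD i (dY1 i σ L) (proj z)
    + ∑ i : Fin 2, ∑ j : Fin 2, formalD i (formalD j (dY2 i j σ L)) z

/-- The generalized Poincaré–Cartan form
`Θ = L ω_0 + (∂L/∂y^σ_j - d_i ∂L/∂y^σ_{ij}) ω^σ ∧ ω_j + ∂L/∂y^σ_{ij} ω^σ_i ∧ ω_j`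
on the third jet prolongation. -/
def poincareCartan (L : JetCoords m 2 → ℝ) (z : JetCoords m 3) :
    JetCoords m 3 [⋀^Fin 2]→L[ℝ] ℝ :=
  L (proj z) • wedge (dx 0) (dx 1)
    + ∑ σ : Fin m, ∑ j : Fin 2,
        (dY1 j σ L (proj z) - ∑ i : Fin 2, formalD i (dY2 i j σ L) z) •
          wedge (om σ z) (omegaBase j)
    + ∑ σ : Fin m, ∑ i : Fin 2, ∑ j : Fin 2,
        dY2 i j σ L (proj z) • wedge (om1 i σ z) (omegaBase j)

/-- Coefficients `P_{σν}`, `Q^j_{σ,ν}`, `R^{i,j}_{σ,ν}`: functions of third order. -/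
structure Coeffs (m : ℕ) where
  P : Fin m → Fin m → JetCoords m 3 → ℝ
  Q : Fin 2 → Fin m → Fin m → JetCoords m 3 → ℝ
  R : Fin 2 → Fin 2 → Fin m → Fin m → JetCoords m 3 → ℝ

/-- The coefficients are smooth on `D`, with `P` skew-symmetric in `σ, ν` and `R` skew-symmetric
in the pairs `(i, σ), (j, ν)`. -/
structure Coeffs.Admissible (K : Coeffs m) (D : Set (JetCoords m 3)) : Prop where
  smooth_P : ∀ σ ν, ContDiffOn ℝ ∞ (K.P σ ν) D
  smooth_Q : ∀ j σ ν, ContDiffOn ℝ ∞ (K.Q j σ ν) D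
  smooth_R : ∀ i j σ ν, ContDiffOn ℝ ∞ (K.R i j σ ν) D
  skew_P : ∀ σ ν, ∀ z ∈ D, K.P σ ν z = -K.P ν σ z
  skew_R : ∀ i j σ ν, ∀ z ∈ D, K.R i j σ ν z = -K.R j i ν σ z

/-- The coefficients agree on `D`. -/
def Coeffs.EqOn (K K' : Coeffs m) (D : Set (JetCoords m 3)) : Prop :=
  ∀ z ∈ D, (∀ σ ν, K.P σ ν z = K'.P σ ν z) ∧ (∀ j σ ν, K.Q j σ ν z = K'.Q j σ ν z) ∧
    (∀ i j σ ν, K.R i j σ ν z = K'.R i j σ ν z)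

/-- `Z = Θ + ½ P_{σν} ω^σ ∧ ω^ν + Q^j_{σ,ν} ω^σ ∧ ω^ν_j + ½ R^{i,j}_{σ,ν} ω^σ_i ∧ ω^ν_j`. -/
def ansatz (L : JetCoords m 2 → ℝ) (K : Coeffs m) (z : JetCoords m 3) :
    JetCoords m 3 [⋀^Fin 2]→L[ℝ] ℝ :=
  poincareCartan L z
    + ∑ σ : Fin m, ∑ ν : Fin m, ((1 / 2 : ℝ) * K.P σ ν z) • wedge (om σ z) (om ν z)
    + ∑ j : Fin 2, ∑ σ : Fin m, ∑ ν : Fin m, K.Q j σ ν z • wedge (om σ z) (om1 j ν z)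
    + ∑ i : Fin 2, ∑ j : Fin 2, ∑ σ : Fin m, ∑ ν : Fin m,
        ((1 / 2 : ℝ) * K.R i j σ ν z) • wedge (om1 i σ z) (om1 j ν z)

/-- `P_{σν}` of the fundamental form, on the second jet prolongation. -/
def fundP (L : JetCoords m 2 → ℝ) (σ ν : Fin m) : JetCoords m 2 → ℝ := fun z =>
  (1 / 2 : ℝ) * (dY1 0 σ (dY1 1 ν L) z - dY1 0 ν (dY1 1 σ L) z)
    + cutD 0 (fun w => dY1 0 ν (dY2 0 1 σ L) w - dY1 0 σ (dY2 0 1 ν L) w) z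
    + cutD 1 (fun w => dY1 1 σ (dY2 0 1 ν L) w - dY1 1 ν (dY2 0 1 σ L) w) z

/-- `Q^1_{σ,ν}` and `Q^2_{σ,ν}` of the fundamental form, on the second jet prolongation. -/
def fundQ (L : JetCoords m 2 → ℝ) (j : Fin 2) (σ ν : Fin m) : JetCoords m 2 → ℝ := fun z =>
  if j = 0 then
    2 * dY1 0 σ (dY2 0 1 ν L) z - dY1 0 ν (dY2 0 1 σ L) z - dY1 1 ν (dY2 0 0 σ L) z
      - 2 * cutD 1 (dY2 0 1 σ (dY2 0 1 ν L)) z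
  else
    -2 * dY1 1 σ (dY2 0 1 ν L) z + dY1 0 ν (dY2 1 1 σ L) z + dY1 1 ν (dY2 0 1 σ L) z
      + 2 * cutD 0 (dY2 0 1 σ (dY2 0 1 ν L)) z

/-- `R^{i,j}_{σ,ν}` of the fundamental form, on the second jet prolongation. -/
def fundR (L : JetCoords m 2 → ℝ) (i j : Fin 2) (σ ν : Fin m) : JetCoords m 2 → ℝ := fun z =>
  if i = j then 0
  else if i = 0 then -2 * dY2 0 1 σ (dY2 0 1 ν L) z
  else 2 * dY2 0 1 σ (dY2 0 1 ν L) z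

/-- The coefficients of the fundamental form, pulled back to the third jet prolongation. -/
def fundCoeffs (L : JetCoords m 2 → ℝ) : Coeffs m where
  P σ ν := fun z => fundP L σ ν (proj z)
  Q j σ ν := fun z => fundQ L j σ ν (proj z)
  R i j σ ν := fun z => fundR L i j σ ν (proj z)

end Coordinates

/-! ### Lagrangians -/

section Lagrangians

variable {m : ℕ} {X Y : Type*}
  [TopologicalSpace X] [ChartedSpace (EuclideanSpace ℝ (Fin 2)) X]
  [TopologicalSpace Y] [ChartedSpace (EuclideanSpace ℝ (Fin (2 + m))) Y]

/-- The image of `V^r` under the associated chart `ψ^r` on `J^r Y`. -/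
def FiberedChart.domain {π : Y → X} (c : FiberedChart (m := m) π) (r : ℕ) :
    Set (JetCoords m r) :=
  {p | (p.1, p.2 0 0) ∈ c.ψ.target}

/-- The associated coordinates `xⁱ(J^r_x γ) = xⁱ(x)`,
`y^σ_{j₁…j_k}(J^r_x γ) = D_{j₁} … D_{j_k} (y^σ γ φ⁻¹)(φ(x))`. -/
def FiberedChart.coords {π : Y → X} (c : FiberedChart (m := m) π) (r : ℕ)
    (s : PointedSection (m := m) π) : JetCoords m r :=
  (c.φ s.base, fun k l σ =>
    iteratedFDeriv ℝ (k : ℕ) (c.rep s) (c.φ s.base)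
      (fun a => Pi.single (if (a : ℕ) + (l : ℕ) < (k : ℕ) then 0 else 1) 1) σ)

/-- `λ = L dx¹ ∧ dx²` on `V²`, with `L` smooth, for a family `form` of 2-forms on the tangent
spaces of the base, indexed by the points of `J² Y`. -/
def FiberedChart.IsExpression {π : Y → X} (c : FiberedChart (m := m) π)
    (form : (j : Jet m π 2) → TangentSpace (𝓡 2) j.base [⋀^Fin 2]→L[ℝ] ℝ)
    (L : JetCoords m 2 → ℝ) : Prop :=
  ContDiffOn ℝ ∞ L (c.domain 2) ∧
    ∀ s : PointedSection (m := m) π, s.γ s.base ∈ c.ψ.source →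
      ∀ v : Fin 2 → TangentSpace (𝓡 2) s.base,
        form (s.jet 2) v = L (c.coords 2 s) *
          Matrix.det (fun a b : Fin 2 =>
            (mfderiv (𝓡 2) 𝓘(ℝ, Fin 2 → ℝ) c.φ s.base (v b) : Fin 2 → ℝ) a)

/-- A second-order Lagrangian: a smooth horizontal 2-form on `J² Y`. A horizontal form at a jet
is the pullback of a unique 2-form on the tangent space of the base at the source of the jet. -/
structure Lagrangian (m : ℕ) {X Y : Type*}
    [TopologicalSpace X] [ChartedSpace (EuclideanSpace ℝ (Fin 2)) X]
    [TopologicalSpace Y] [ChartedSpace (EuclideanSpace ℝ (Fin (2 + m))) Y] (π : Y → X) where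
  form : (j : Jet m π 2) → TangentSpace (𝓡 2) j.base [⋀^Fin 2]→L[ℝ] ℝ
  smooth : ∀ c : FiberedChart (m := m) π, ∃ L, c.IsExpression form L

/-- `L` is the Lagrange function associated with the Lagrangian and the chart. -/
def Lagrangian.IsLagrangeFunction {π : Y → X} (lam : Lagrangian m π)
    (c : FiberedChart (m := m) π) (L : JetCoords m 2 → ℝ) : Prop :=
  c.IsExpression lam.form L

/-- The order-reducibility condition holds in every fibered chart. -/
def Lagrangian.OrderReducible {π : Y → X} (lam : Lagrangian m π) : Prop :=
  ∀ (c : FiberedChart (m := m) π) (L : JetCoords m 2 → ℝ), lam.IsLagrangeFunction c L →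
    ∀ z ∈ c.domain 2, OrderConditionAt L z

/-- Variational triviality: the Euler–Lagrange form vanishes identically on `J⁴ Y`. -/
def Lagrangian.IsTrivial {π : Y → X} (lam : Lagrangian m π) : Prop :=
  ∀ (c : FiberedChart (m := m) π) (L : JetCoords m 2 → ℝ), lam.IsLagrangeFunction c L →
    ∀ z ∈ c.domain 4, ∀ σ, eulerLagrange L σ z = 0

/-- A 2-form on `V³`, in coordinates, is closed. -/
def FiberedChart.IsClosedForm {π : Y → X} (c : FiberedChart (m := m) π)
    (η : JetCoords m 3 → JetCoords m 3 [⋀^Fin 2]→L[ℝ] ℝ) : Prop :=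
  ∀ z ∈ c.domain 3, extDeriv η z = 0

end Lagrangians

end FundLepage

end

open scoped Manifold ContDiff
open FundLepage

noncomputable section

namespace FundLepage

/-! ### Smooth functions on an open set and derivations along affine vector fields -/

section SmoothFunctions

open TopologicalSpace (Opens)

variable {E : Type*} [NormedAddCommGroup E] [NormedSpace ℝ E]

/-! Everything happens in one chart, in the frame on the third jet space formed by E_i = `cutVec i`
and the vertical vectors `coordVec k l σ`. These fields are affine, the E_i commute, and the bracket
of ∂/∂y_J with E_i is ∂/∂y of J with one index i removed, or zero. The form Z is described by its
values on this frame (`FormTable`). Values with an argument E_i depend on L alone; P, Q, R are its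
values on pairs of vertical vectors.

Uniqueness. Two closed forms Z differ by a closed 2-form annihilated by E_0 and by the vertical
vectors of order three. If E_0 and a constant vector u annihilate a closed form, so does the bracket
[u, E_0] (`form_two_bracket_eq_zero`). Removing one index 1 at a time from third-order multi-indices
reaches every vertical vector of lower order, so the difference vanishes on vertical pairs and the
coefficients agree.

Existence. Let Ω = dZ with the coefficients (∗). The order condition and the Euler–Lagrange
equations, differentiated in third-order coordinates, give the exchange relations (`exchange_zero`,
`exchange_one`). With these, all frame values of Z are of second order, so Ω is annihilated by
third-order vertical vectors (`extDeriv_vert_three_left`). Also Ω(E_0, E_1, ·) = 0, which is the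
Euler–Lagrange equation together with the definition of the momenta (`extDeriv_cutVec_cutVec`).

Few components of Ω are then computed directly: those with E_0 and ∂/∂y_11 or ∂/∂y_12, the one with
E_0 and two vectors ∂/∂y_1, and half of the information on Ω(E_0, ∂/∂y_1, ∂/∂y). The rest follows
from dΩ = 0. Evaluated on E_0, E_1, u, v it relates the contractions of Ω with E_0 and E_1
(`contraction_relation`), and this forces the contraction with E_0 to vanish
(`extDeriv_cutVec_zero`). The bracket argument, now for 3-forms, descends from order three to all
vertical vectors, whence Ω = 0. -/

/-- The smooth functions on an open set `D`, extended by zero outside `D`. -/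
def smoothFn (D : Opens E) : Submodule ℝ (E → ℝ) where
  carrier := {f | ContDiffOn ℝ ∞ f D ∧ ∀ z ∉ D, f z = 0}
  add_mem' hf hg := ⟨hf.1.add hg.1, fun z hz => by simp [hf.2 z hz, hg.2 z hz]⟩
  zero_mem' := ⟨contDiffOn_const, fun _ _ => rfl⟩
  smul_mem' c f hf := ⟨contDiffOn_const.smul hf.1, fun z hz => by simp [hf.2 z hz]⟩

/-- The affine vector field `z ↦ e + N z`. -/
def affineField (e : E) (N : E →L[ℝ] E) (z : E) : E := e + N z

theorem contDiff_affineField (e : E) (N : E →L[ℝ] E) : ContDiff ℝ ∞ (affineField e N) :=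
  contDiff_const.add N.contDiff

theorem hasFDerivAt_affineField (e : E) (N : E →L[ℝ] E) (z : E) :
    HasFDerivAt (affineField e N) N z :=
  N.hasFDerivAt.const_add e

@[simp] theorem affineField_zero (e : E) (z : E) : affineField e 0 z = e := by simp [affineField]

variable {D : Opens E}

@[ext] theorem smoothFn.ext {f g : smoothFn D} (h : ∀ z ∈ D, (f : E → ℝ) z = (g : E → ℝ) z) :
    f = g := by
  apply Subtype.ext
  funext z
  by_cases hz : z ∈ D
  · exact h z hz
  · rw [f.2.2 z hz, g.2.2 z hz]

/-- The restriction to `D` of a function that is smooth on `D`. -/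
def restr (f : E → ℝ) (hf : ContDiffOn ℝ ∞ f D) : smoothFn D :=
  ⟨(D : Set E).indicator f, hf.congr fun _ hz => Set.indicator_of_mem hz f,
    fun _ hz => Set.indicator_of_notMem hz f⟩

theorem restr_apply {f : E → ℝ} (hf : ContDiffOn ℝ ∞ f D) {z : E} (hz : z ∈ D) :
    (restr f hf : E → ℝ) z = f z :=
  Set.indicator_of_mem hz f

theorem contDiffAt_smoothFn (f : smoothFn D) {z : E} (hz : z ∈ D) :
    ContDiffAt ℝ ∞ (f : E → ℝ) z :=
  f.2.1.contDiffAt (D.isOpen.mem_nhds hz)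

theorem differentiableAt_smoothFn (f : smoothFn D) {z : E} (hz : z ∈ D) :
    DifferentiableAt ℝ (f : E → ℝ) z :=
  (contDiffAt_smoothFn f hz).differentiableAt (by simp)

theorem contDiffOn_fderiv_apply {F : Type*} [NormedAddCommGroup F] [NormedSpace ℝ F]
    {f : F → ℝ} {D : Set F} (hD : IsOpen D) (hf : ContDiffOn ℝ ∞ f D) {X : F → F}
    (hX : ContDiffOn ℝ ∞ X D) : ContDiffOn ℝ ∞ (fun z => fderiv ℝ f z (X z)) D :=
  (hf.fderiv_of_isOpen hD (by simp)).clm_apply hX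

/-- The derivative along the affine vector field `z ↦ e + N z`, an endomorphism of the space of
smooth functions on `D`. -/
def der (e : E) (N : E →L[ℝ] E) : smoothFn D →ₗ[ℝ] smoothFn D where
  toFun f := restr (fun z => fderiv ℝ f z (affineField e N z))
    (contDiffOn_fderiv_apply D.isOpen f.2.1 (contDiff_affineField e N).contDiffOn)
  map_add' f g := by
    ext z hz
    have := fderiv_add (differentiableAt_smoothFn f hz) (differentiableAt_smoothFn g hz)
    simp [restr_apply _ hz, this]
  map_smul' c f := by
    ext z hz
    have := fderiv_const_smul (differentiableAt_smoothFn f hz) c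
    simp [restr_apply _ hz, this]

theorem der_apply {e : E} {N : E →L[ℝ] E} {f : smoothFn D} {g : E → ℝ} {z : E}
    (h : Set.EqOn f g D) (hz : z ∈ D) :
    (der e N f : E → ℝ) z = fderiv ℝ g z (affineField e N z) := by
  have h0 : (der e N f : E → ℝ) z = fderiv ℝ f z (affineField e N z) :=
    restr_apply (contDiffOn_fderiv_apply D.isOpen f.2.1
      (contDiff_affineField e N).contDiffOn) hz
  rw [h0, (h.eventuallyEq_of_mem (D.isOpen.mem_nhds hz)).fderiv_eq]

theorem der_der_apply (e e' : E) (N N' : E →L[ℝ] E) (f : smoothFn D) {z : E} (hz : z ∈ D) :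
    (der e N (der e' N' f) : E → ℝ) z =
      fderiv ℝ (fderiv ℝ (f : E → ℝ)) z (affineField e N z) (affineField e' N' z) +
        fderiv ℝ (f : E → ℝ) z (N' (affineField e N z)) := by
  rw [der_apply (fun w hw => der_apply (fun _ _ => rfl) hw) hz]
  have h1 : DifferentiableAt ℝ (fderiv ℝ (f : E → ℝ)) z :=
    ((contDiffAt_smoothFn f hz).fderiv_right (m := ∞) (by simp)).differentiableAt (by simp)
  have := h1.hasFDerivAt.clm_apply (hasFDerivAt_affineField e' N' z)
  rw [this.fderiv]
  simp [add_comm]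

/-- The commutator of the derivatives along two affine vector fields. -/
theorem der_comm (e e' : E) (N N' : E →L[ℝ] E) (f : smoothFn D) :
    der e N (der e' N' f) = der e' N' (der e N f) +
      der (N' e - N e') (N' ∘L N - N ∘L N') f := by
  ext z hz
  have hs : IsSymmSndFDerivAt ℝ (f : E → ℝ) z :=
    (contDiffAt_smoothFn f hz).isSymmSndFDerivAt
      (by rw [minSmoothness_of_isRCLikeNormedField]
          exact WithTop.coe_le_coe.2 (le_top : (2 : ℕ∞) ≤ ⊤))
  rw [Submodule.coe_add, Pi.add_apply, der_der_apply _ _ _ _ _ hz, der_der_apply _ _ _ _ _ hz,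
    der_apply (fun _ _ => rfl) hz, hs.eq, add_assoc, ← map_add]
  congr 2
  simp only [affineField, map_add, sub_apply, ContinuousLinearMap.comp_apply]
  abel

end SmoothFunctions

/-! ### The exterior derivative along affine vector fields -/

section Cartan

open TopologicalSpace (Opens)

variable {E : Type*} [NormedAddCommGroup E] [NormedSpace ℝ E]

theorem form_two_swap (α : E [⋀^Fin 2]→L[ℝ] ℝ) (a b : E) : α ![a, b] = -α ![b, a] := by
  have h : α (![b, a] ∘ Equiv.swap 0 1) = -α ![b, a] :=
    α.toAlternatingMap.map_swap ![b, a] (by decide)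
  rw [← h]
  congr 1
  funext i
  fin_cases i <;> rfl

theorem form_three_swap (α : E [⋀^Fin 3]→L[ℝ] ℝ) (a b c : E) :
    α ![a, b, c] = -α ![b, a, c] := by
  have h : α (![b, a, c] ∘ Equiv.swap 0 1) = -α ![b, a, c] :=
    α.toAlternatingMap.map_swap ![b, a, c] (by decide)
  rw [← h]
  congr 1
  funext i
  fin_cases i <;> rfl

theorem form_three_swap_right (α : E [⋀^Fin 3]→L[ℝ] ℝ) (a b c : E) :
    α ![a, b, c] = -α ![a, c, b] := by
  have h : α (![a, c, b] ∘ Equiv.swap 1 2) = -α ![a, c, b] :=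
    α.toAlternatingMap.map_swap ![a, c, b] (by decide)
  rw [← h]
  congr 1
  funext i
  fin_cases i <;> rfl

theorem fderiv_form_two {η : E → E [⋀^Fin 2]→L[ℝ] ℝ} {z : E} (hη : DifferentiableAt ℝ η z)
    (e e' : E) (N N' : E →L[ℝ] E) (u : E) :
    fderiv ℝ (fun z => η z ![affineField e N z, affineField e' N' z]) z u =
      fderiv ℝ η z u ![affineField e N z, affineField e' N' z] +
        η z ![N u, affineField e' N' z] + η z ![affineField e N z, N' u] := by
  have hV : ∀ i : Fin 2, HasFDerivAt
      (fun z => (![affineField e N z, affineField e' N' z] : Fin 2 → E) i)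
      ((![N, N'] : Fin 2 → E →L[ℝ] E) i) z := by
    intro i
    fin_cases i
    · exact hasFDerivAt_affineField e N z
    · exact hasFDerivAt_affineField e' N' z
  have h := fderiv_continuousAlternatingMap_apply_apply hη (fun i => (hV i).differentiableAt) u
  rw [h, Fin.sum_univ_two, (hV 0).fderiv, (hV 1).fderiv]
  have h0 : Function.update ![affineField e N z, affineField e' N' z] 0 (N u) =
      ![N u, affineField e' N' z] := by
    funext i; fin_cases i <;> rfl
  have h1 : Function.update ![affineField e N z, affineField e' N' z] 1 (N' u) =
      ![affineField e N z, N' u] := by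
    funext i; fin_cases i <;> rfl
  have e0 : (![N, N'] : Fin 2 → E →L[ℝ] E) 0 u = N u := rfl
  have e1 : (![N, N'] : Fin 2 → E →L[ℝ] E) 1 u = N' u := rfl
  rw [e0, e1, h0, h1]
  ring

theorem fderiv_form_three {η : E → E [⋀^Fin 3]→L[ℝ] ℝ} {z : E} (hη : DifferentiableAt ℝ η z)
    (e e' w : E) (N N' : E →L[ℝ] E) (u : E) :
    fderiv ℝ (fun z => η z ![affineField e N z, affineField e' N' z, w]) z u =
      fderiv ℝ η z u ![affineField e N z, affineField e' N' z, w] +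
        η z ![N u, affineField e' N' z, w] + η z ![affineField e N z, N' u, w] := by
  have hV : ∀ i : Fin 3, HasFDerivAt
      (fun z => (![affineField e N z, affineField e' N' z, w] : Fin 3 → E) i)
      ((![N, N', 0] : Fin 3 → E →L[ℝ] E) i) z := by
    intro i
    fin_cases i
    · exact hasFDerivAt_affineField e N z
    · exact hasFDerivAt_affineField e' N' z
    · exact hasFDerivAt_const w z
  have h := fderiv_continuousAlternatingMap_apply_apply hη (fun i => (hV i).differentiableAt) u
  rw [h, Fin.sum_univ_three, (hV 0).fderiv, (hV 1).fderiv, (hV 2).fderiv]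
  have h0 : Function.update ![affineField e N z, affineField e' N' z, w] 0 (N u) =
      ![N u, affineField e' N' z, w] := by
    funext i; fin_cases i <;> rfl
  have h1 : Function.update ![affineField e N z, affineField e' N' z, w] 1 (N' u) =
      ![affineField e N z, N' u, w] := by
    funext i; fin_cases i <;> rfl
  have e0 : (![N, N', 0] : Fin 3 → E →L[ℝ] E) 0 u = N u := rfl
  have e1 : (![N, N', 0] : Fin 3 → E →L[ℝ] E) 1 u = N' u := rfl
  have e2 : (![N, N', 0] : Fin 3 → E →L[ℝ] E) 2 u = 0 := rfl
  rw [e0, e1, e2, h0, h1, (η z).map_coord_zero 2 (Function.update_self ..)]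
  ring

theorem extDeriv_form_two (η : E → E [⋀^Fin 2]→L[ℝ] ℝ) (z a b c : E) :
    extDeriv η z ![a, b, c] =
      fderiv ℝ η z a ![b, c] - fderiv ℝ η z b ![a, c] + fderiv ℝ η z c ![a, b] := by
  rw [extDeriv, ContinuousAlternatingMap.alternatizeUncurryFin_apply, Fin.sum_univ_three]
  have h0 : Fin.removeNth 0 ![a, b, c] = ![b, c] := by funext i; fin_cases i <;> rfl
  have h1 : Fin.removeNth 1 ![a, b, c] = ![a, c] := by funext i; fin_cases i <;> rfl
  have h2 : Fin.removeNth 2 ![a, b, c] = ![a, b] := by funext i; fin_cases i <;> rfl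
  rw [h0, h1, h2]
  simp [sub_eq_add_neg]

theorem extDeriv_form_three (η : E → E [⋀^Fin 3]→L[ℝ] ℝ) (z a b c d : E) :
    extDeriv η z ![a, b, c, d] =
      fderiv ℝ η z a ![b, c, d] - fderiv ℝ η z b ![a, c, d] + fderiv ℝ η z c ![a, b, d]
        - fderiv ℝ η z d ![a, b, c] := by
  rw [extDeriv, ContinuousAlternatingMap.alternatizeUncurryFin_apply, Fin.sum_univ_four]
  have h0 : Fin.removeNth 0 ![a, b, c, d] = ![b, c, d] := by funext i; fin_cases i <;> rfl
  have h1 : Fin.removeNth 1 ![a, b, c, d] = ![a, c, d] := by funext i; fin_cases i <;> rfl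
  have h2 : Fin.removeNth 2 ![a, b, c, d] = ![a, b, d] := by funext i; fin_cases i <;> rfl
  have h3 : Fin.removeNth 3 ![a, b, c, d] = ![a, b, c] := by funext i; fin_cases i <;> rfl
  rw [h0, h1, h2, h3]
  simp [sub_eq_add_neg, pow_succ]

variable {D : Opens E}

/-- Cartan's formula for a 2-form on three affine vector fields. -/
theorem extDeriv_affineField {η : E → E [⋀^Fin 2]→L[ℝ] ℝ} {z : E} (hη : DifferentiableAt ℝ η z)
    (hz : z ∈ D) {e₀ e₁ e₂ : E} {N₀ N₁ N₂ : E →L[ℝ] E} {f₀ f₁ f₂ : smoothFn D}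
    (h₀ : ∀ z ∈ D, f₀.1 z = η z ![affineField e₁ N₁ z, affineField e₂ N₂ z])
    (h₁ : ∀ z ∈ D, f₁.1 z = η z ![affineField e₀ N₀ z, affineField e₂ N₂ z])
    (h₂ : ∀ z ∈ D, f₂.1 z = η z ![affineField e₀ N₀ z, affineField e₁ N₁ z]) :
    extDeriv η z ![affineField e₀ N₀ z, affineField e₁ N₁ z, affineField e₂ N₂ z] =
      (der e₀ N₀ f₀ - der e₁ N₁ f₁ + der e₂ N₂ f₂).1 z
        - (η z ![N₁ (affineField e₀ N₀ z), affineField e₂ N₂ z]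
            - η z ![N₀ (affineField e₁ N₁ z), affineField e₂ N₂ z])
        + (η z ![N₂ (affineField e₀ N₀ z), affineField e₁ N₁ z]
            - η z ![N₀ (affineField e₂ N₂ z), affineField e₁ N₁ z])
        - (η z ![N₂ (affineField e₁ N₁ z), affineField e₀ N₀ z]
            - η z ![N₁ (affineField e₂ N₂ z), affineField e₀ N₀ z]) := by
  have key : (der e₀ N₀ f₀ - der e₁ N₁ f₁ + der e₂ N₂ f₂).1 z =
      (der e₀ N₀ f₀).1 z - (der e₁ N₁ f₁).1 z + (der e₂ N₂ f₂).1 z := rfl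
  rw [key, der_apply h₀ hz, der_apply h₁ hz, der_apply h₂ hz, fderiv_form_two hη,
    fderiv_form_two hη, fderiv_form_two hη, extDeriv_form_two,
    form_two_swap _ (affineField e₁ N₁ z) (N₂ _), form_two_swap _ (affineField e₀ N₀ z) (N₂ _),
    form_two_swap _ (affineField e₀ N₀ z) (N₁ _)]
  ring

theorem fderiv_form_eq_zero {n : ℕ} {η : E → E [⋀^Fin n]→L[ℝ] ℝ} {z : E}
    (hη : DifferentiableAt ℝ η z) (hz : z ∈ D) {v : Fin n → E} (h : ∀ z ∈ D, η z v = 0) (u : E) :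
    fderiv ℝ η z u v = 0 := by
  have h1 : (fun z => η z v) =ᶠ[nhds z] fun _ => 0 :=
    Filter.eventually_of_mem (D.isOpen.mem_nhds hz) h
  have h2 := h1.fderiv_eq (𝕜 := ℝ)
  rw [← fderiv_continuousAlternatingMap_apply_const_apply hη, h2]
  simp

/-- If `E` annihilates the closed 2-form `η`, so does `[u, E]` for every constant `u` that
annihilates `η`. -/
theorem form_two_bracket_eq_zero {η : E → E [⋀^Fin 2]→L[ℝ] ℝ} {e u : E} {N : E →L[ℝ] E}
    (hη : ∀ z ∈ D, DifferentiableAt ℝ η z) (hd : ∀ z ∈ D, extDeriv η z = 0)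
    (hE : ∀ z ∈ D, ∀ v, η z ![affineField e N z, v] = 0) (hu : ∀ z ∈ D, ∀ v, η z ![u, v] = 0)
    {z : E} (hz : z ∈ D) (v : E) : η z ![N u, v] = 0 := by
  -- In dη(E, u, v) = 0 the functions η(E, ·) and η(u, ·) vanish identically, so only the terms from
  -- differentiating the coefficients of E remain; N u is the bracket [u, E].
  have h0 := extDeriv_form_two η z (affineField e N z) u v
  rw [hd z hz] at h0
  have h1 := fderiv_form_two (hη z hz) e v N 0 u
  have h2 := fderiv_form_two (hη z hz) e u N 0 v
  have k : ∀ w, (fun z => η z ![affineField e N z, affineField w 0 z]) =ᶠ[nhds z] fun _ => 0 :=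
    fun w => Filter.eventually_of_mem (D.isOpen.mem_nhds hz) fun z hz => hE z hz _
  rw [(k v).fderiv_eq] at h1
  rw [(k u).fderiv_eq] at h2
  have h3 := fderiv_form_eq_zero (hη z hz) hz (fun z hz => hu z hz v) (affineField e N z)
  have h4 := hu z hz (N v)
  rw [form_two_swap] at h4
  have h5 := hE z hz 0
  simp only [affineField_zero, fderiv_fun_const, Pi.zero_apply, zero_apply,
    ContinuousAlternatingMap.coe_zero, Pi.zero_apply] at h0 h1 h2
  linarith

/-- If `E` annihilates the closed 3-form `η`, so does `[u, E]` for every constant `u` that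
annihilates `η`. -/
theorem form_three_bracket_eq_zero {η : E → E [⋀^Fin 3]→L[ℝ] ℝ} {e u : E} {N : E →L[ℝ] E}
    (hη : ∀ z ∈ D, DifferentiableAt ℝ η z) (hd : ∀ z ∈ D, extDeriv η z = 0)
    (hE : ∀ z ∈ D, ∀ v w, η z ![affineField e N z, v, w] = 0)
    (hu : ∀ z ∈ D, ∀ v w, η z ![u, v, w] = 0)
    {z : E} (hz : z ∈ D) (v w : E) : η z ![N u, v, w] = 0 := by
  have h0 := extDeriv_form_three η z (affineField e N z) u v w
  rw [hd z hz] at h0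
  have h (a b c : E) : fderiv ℝ η z c ![affineField e N z, a, b] = -η z ![N c, a, b] := by
    have h1 := fderiv_form_three (hη z hz) e a b N 0 c
    have k : (fun z => η z ![affineField e N z, affineField a 0 z, b]) =ᶠ[nhds z] fun _ => 0 :=
      Filter.eventually_of_mem (D.isOpen.mem_nhds hz) fun z hz => hE z hz _ _
    have h5 := hE z hz 0 b
    rw [k.fderiv_eq] at h1
    simp only [affineField_zero, fderiv_fun_const, Pi.zero_apply, zero_apply] at h1
    linarith
  rw [h, h, h, form_three_swap _ (N v), form_three_swap _ (N w), hu z hz, hu z hz,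
    fderiv_form_eq_zero (hη z hz) hz (fun z hz => hu z hz v w)] at h0
  simpa using h0.symm

/-- The relation between the contractions of a closed 3-form with two commuting affine vector
fields whose joint contraction vanishes. -/
theorem form_three_contraction_relation {η : E → E [⋀^Fin 3]→L[ℝ] ℝ} {e e' u v : E}
    {N N' : E →L[ℝ] E} {z : E} (hη : DifferentiableAt ℝ η z) (hd : extDeriv η z = 0) (hz : z ∈ D)
    (hcomm : N' (affineField e N z) = N (affineField e' N' z))
    (hE : ∀ z ∈ D, ∀ w, η z ![affineField e N z, affineField e' N' z, w] = 0)
    (h : ∀ z ∈ D, η z ![affineField e N z, u, v] = 0)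
    (h' : ∀ z ∈ D, η z ![affineField e' N' z, u, v] = 0) :
    η z ![affineField e' N' z, N u, v] + η z ![affineField e' N' z, u, N v] =
      η z ![affineField e N z, N' u, v] + η z ![affineField e N z, u, N' v] := by
  -- All function values being differentiated in dη(E, E', u, v) = 0 are zero. What survives are
  -- bracket terms, and those of [E, E'] cancel by `hcomm`.
  have h0 := extDeriv_form_three η z (affineField e N z) (affineField e' N' z) u v
  rw [hd] at h0
  have key (a b : E) : fderiv ℝ η z a ![affineField e N z, affineField e' N' z, b] =
      -η z ![N a, affineField e' N' z, b] - η z ![affineField e N z, N' a, b] := by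
    have h1 := fderiv_form_three hη e e' b N N' a
    have k : (fun z => η z ![affineField e N z, affineField e' N' z, b]) =ᶠ[nhds z]
        fun _ => 0 :=
      Filter.eventually_of_mem (D.isOpen.mem_nhds hz) fun z hz => hE z hz _
    rw [k.fderiv_eq] at h1
    simp only [fderiv_fun_const, Pi.zero_apply, zero_apply] at h1
    linarith
  have key' (e : E) (N : E →L[ℝ] E) (h : ∀ z ∈ D, η z ![affineField e N z, u, v] = 0) (c : E) :
      fderiv ℝ η z c ![affineField e N z, u, v] = -η z ![N c, u, v] := by
    have h1 := fderiv_form_three hη e u v N 0 c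
    have k : (fun z => η z ![affineField e N z, affineField u 0 z, v]) =ᶠ[nhds z] fun _ => 0 :=
      Filter.eventually_of_mem (D.isOpen.mem_nhds hz) fun z hz => by simpa using h z hz
    have h5 : η z ![affineField e N z, 0, v] = 0 := (η z).map_coord_zero 1 rfl
    rw [k.fderiv_eq] at h1
    simp only [affineField_zero, fderiv_fun_const, Pi.zero_apply, zero_apply] at h1
    linarith
  rw [key, key, key' e N h, key' e' N' h', hcomm, form_three_swap _ (N u), form_three_swap _ (N v),
    form_three_swap_right _ _ (N v), form_three_swap_right _ _ (N' v)] at h0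
  simp only [ContinuousAlternatingMap.coe_zero, Pi.zero_apply] at h0
  linarith

end Cartan

/-! ### The adapted frame on the third jet prolongation -/

section Frame

open TopologicalSpace (Opens)

variable {m r : ℕ}

/-- The coordinate vector `∂/∂xⁱ`. -/
def vecX (i : Fin 2) : JetCoords m r := (Pi.single i 1, 0)

/-- The vector `∂/∂y^σ_J` for `J` of length `k` with `l` entries `2`, zero if there is no such
coordinate. -/
def coordVec (k l : ℕ) (σ : Fin m) : JetCoords m r :=
  (0, fun k' l' τ => if (k' : ℕ) = k ∧ (l' : ℕ) = l ∧ τ = σ then 1 else 0)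

theorem vecY_eq_coordVec (k l : ℕ) (hk : k < r + 1) (hl : l < k + 1) (σ : Fin m) :
    (vecY k l hk hl σ : JetCoords m r) = coordVec k l σ := by
  refine Prod.ext rfl ?_
  funext k' l' τ
  simp only [vecY, coordVec]
  rcases eq_or_ne k' ⟨k, hk⟩ with rfl | hne
  · rw [Pi.single_eq_same]
    rcases eq_or_ne l' ⟨l, hl⟩ with rfl | hne
    · rw [Pi.single_eq_same]
      simp [Pi.single_apply]
    · rw [Pi.single_eq_of_ne hne]
      have : (l' : ℕ) ≠ l := fun h => hne (Fin.ext h)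
      simp [this]
  · rw [Pi.single_eq_of_ne hne]
    have : (k' : ℕ) ≠ k := fun h => hne (Fin.ext h)
    simp [this]

theorem coordVec_eq_zero {k l : ℕ} (h : r < k ∨ k < l) (σ : Fin m) :
    (coordVec k l σ : JetCoords m r) = 0 := by
  refine Prod.ext rfl ?_
  funext k' l' τ
  have h1 := k'.isLt
  have h2 := l'.isLt
  simp only [coordVec, Prod.snd_zero, Pi.zero_apply, ite_eq_right_iff]
  omega

/-- The linear part of the vector field `cutVec i`. -/
def shift (i : Fin 2) : JetCoords m r →L[ℝ] JetCoords m r :=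
  LinearMap.toContinuousLinearMap
    { toFun := fun p => (0, (cutVec i p).2)
      map_add' := fun p q => by
        refine Prod.ext (by simp) ?_
        funext k l σ
        by_cases h : (k : ℕ) < r <;> simp [cutVec, h]
      map_smul' := fun c p => by
        refine Prod.ext (by simp) ?_
        funext k l σ
        by_cases h : (k : ℕ) < r <;> simp [cutVec, h] }

theorem shift_apply (i : Fin 2) (p : JetCoords m r) : shift i p = (0, (cutVec i p).2) := rfl

theorem cutVec_eq_affineField (i : Fin 2) (p : JetCoords m r) :
    cutVec i p = affineField (vecX i) (shift i) p :=
  Prod.ext (by simp [cutVec, affineField, vecX, shift_apply])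
    (by simp [affineField, vecX, shift_apply])

theorem shift_vecX (i j : Fin 2) : shift i (vecX j : JetCoords m r) = 0 := by
  rw [shift_apply]
  refine Prod.ext rfl ?_
  funext k l σ
  simp [cutVec, vecX]

/-- Appending two indices to a multi-index does not depend on their order. This is the commutation
of the two cut formal derivatives. -/
theorem shift_shift (i j : Fin 2) (p : JetCoords m r) :
    shift i (shift j p) = shift j (shift i p) := by
  refine Prod.ext rfl ?_
  funext k l σ
  by_cases h : (k : ℕ) < r
  · by_cases h' : (k : ℕ) + 1 < r
    · simp [shift_apply, cutVec, h, h', add_assoc, add_comm (i : ℕ)]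
    · simp [shift_apply, cutVec, h, h']
  · simp [shift_apply, cutVec, h]

/-- The bracket of ∂/∂y_{Ji} with `cutVec i` is ∂/∂y_J. Since `i` is 0 or 1, appending it to J
raises the number of entries 2 from `l` to `l + i`. -/
theorem shift_coordVec (i : Fin 2) {k l : ℕ} (hk : k < r) (σ : Fin m) :
    shift i (coordVec (k + 1) (l + i) σ : JetCoords m r) = coordVec k l σ := by
  refine Prod.ext rfl ?_
  funext k' l' τ
  by_cases h : (k' : ℕ) < r
  · simp [shift_apply, cutVec, h, coordVec]
  · have : (k' : ℕ) ≠ k := by omega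
    simp [shift_apply, cutVec, h, coordVec, this]

/-- There is no index to remove: the multi-index is empty, or i is the index 2 and J has no entry 2.
The remaining case, removing 1 from a string of 2's, falls under `shift_coordVec`, where the result
is the zero vector by convention. -/
theorem shift_coordVec_of_lt (i : Fin 2) {k l : ℕ} (h : k = 0 ∨ l < i) (σ : Fin m) :
    shift i (coordVec k l σ : JetCoords m r) = 0 := by
  refine Prod.ext rfl ?_
  funext k' l' τ
  by_cases h' : (k' : ℕ) < r
  · simp only [shift_apply, cutVec, h', coordVec, dite_true, Prod.snd_zero, Pi.zero_apply,
      ite_eq_right_iff]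
    omega
  · simp [shift_apply, cutVec, h']

theorem eq_sum_coordVec (p : JetCoords m r) :
    p = p.1 0 • vecX 0 + p.1 1 • vecX 1 +
      ∑ k : Fin (r + 1), ∑ l : Fin ((k : ℕ) + 1), ∑ σ : Fin m, p.2 k l σ • coordVec k l σ := by
  refine Prod.ext ?_ ?_
  · funext i
    simp only [Prod.fst_add, Prod.fst_sum, Prod.smul_fst]
    fin_cases i <;> simp [vecX, coordVec]
  · funext k l σ
    simp only [Prod.snd_add, Prod.snd_sum, Prod.smul_snd, vecX, coordVec, smul_zero, zero_add,
      Finset.sum_apply, Pi.smul_apply, Pi.add_apply, Pi.zero_apply]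
    rw [Finset.sum_eq_single k, Finset.sum_eq_single l, Finset.sum_eq_single σ]
    · simp
    · intro τ _ h
      simp [h.symm]
    · simp
    · intro l' _ h
      have : (l : ℕ) ≠ l' := fun e => h (Fin.ext e.symm)
      simp [this]
    · simp
    · intro k' _ h
      have : (k : ℕ) ≠ k' := fun e => h (Fin.ext e.symm)
      simp [this]
    · simp

/-- The vector fields `cutVec 0`, `cutVec 1` and the vertical coordinate vectors span. -/
theorem linearMap_eq_zero_of_frame (z : JetCoords m r) (f : JetCoords m r →ₗ[ℝ] ℝ)
    (hE : ∀ i, f (cutVec i z) = 0) (hv : ∀ k l σ, f (coordVec k l σ) = 0) : f = 0 := by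
  have hvert (q : JetCoords m r) (hq : q.1 = 0) : f q = 0 := by
    rw [eq_sum_coordVec q]
    simp [hq, hv]
  have hX (i : Fin 2) : f (vecX i) = 0 := by
    have h := hE i
    rw [cutVec_eq_affineField, affineField, map_add, hvert (shift i z) rfl, add_zero] at h
    exact h
  refine LinearMap.ext fun p => ?_
  rw [eq_sum_coordVec p]
  simp [hX, hv]

/-! ### Jet coordinates over an open set -/

/-- The open set of jet coordinates over an open set `T` of coordinates `(xⁱ, y^σ)`. -/
def jetDomain (T : Opens ((Fin 2 → ℝ) × (Fin m → ℝ))) (r : ℕ) : Opens (JetCoords m r) :=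
  ⟨{p | (p.1, p.2 0 0) ∈ T}, T.isOpen.preimage (by fun_prop)⟩

/-- `proj` as a continuous linear map. -/
def projL : JetCoords m (r + 1) →L[ℝ] JetCoords m r :=
  LinearMap.toContinuousLinearMap
    { toFun := proj
      map_add' := fun _ _ => rfl
      map_smul' := fun _ _ => rfl }

theorem proj_mem {T : Opens ((Fin 2 → ℝ) × (Fin m → ℝ))} {p : JetCoords m (r + 1)}
    (hp : p ∈ jetDomain T (r + 1)) : proj p ∈ jetDomain T r := hp

theorem proj_coordVec (k l : ℕ) (σ : Fin m) :
    proj (coordVec k l σ : JetCoords m (r + 1)) = coordVec k l σ := rfl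

theorem proj_cutVec (i : Fin 2) (p : JetCoords m (r + 1)) : proj (cutVec i p) = formalVec i p := by
  refine Prod.ext rfl ?_
  funext k l σ
  have : (k : ℕ) < r + 1 := k.isLt
  simp only [proj, cutVec, formalVec, Fin.val_castSucc, this, dite_true]
  rfl

/-- Formal and cut derivatives differ only by derivatives in the coordinates of top order, hence
agree on functions that do not depend on these. -/
theorem formalVec_eq_cutVec_add (i : Fin 2) (p : JetCoords m (r + 1)) :
    formalVec i p = cutVec i (proj p) + ∑ l : Fin (r + 1), ∑ σ : Fin m,
      p.2 (Fin.last (r + 1)) ⟨(l : ℕ) + i, by simp; omega⟩ σ • coordVec r l σ := by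
  refine Prod.ext ?_ ?_
  · simp [formalVec, cutVec, Prod.fst_sum, coordVec]
  · funext k l σ
    simp only [Prod.snd_add, Prod.snd_sum, Prod.smul_snd, coordVec,
      Finset.sum_apply, Pi.smul_apply, Pi.add_apply]
    by_cases hk : (k : ℕ) < r
    · have : (k : ℕ) ≠ r := by omega
      simp [formalVec, cutVec, hk, this, proj]
      rfl
    · obtain rfl : k = Fin.last r := Fin.ext (by simp; omega)
      rw [Finset.sum_eq_single (Fin.cast (by simp) l), Finset.sum_eq_single σ]
      · simp [formalVec, cutVec]
      · intro τ _ h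
        simp [h.symm]
      · simp
      · intro l' _ h
        have : (l : ℕ) ≠ l' := fun e => h (Fin.ext e.symm)
        simp [this]
      · simp

variable {T : Opens ((Fin 2 → ℝ) × (Fin m → ℝ))}

/-- The derivative in the coordinate `y^σ_J` of functions of third order. -/
def dVert (k l : ℕ) (σ : Fin m) : smoothFn (jetDomain T 3) →ₗ[ℝ] smoothFn (jetDomain T 3) :=
  der (coordVec k l σ) 0

/-- The cut formal derivative of functions of third order. -/
def dCut (i : Fin 2) : smoothFn (jetDomain T 3) →ₗ[ℝ] smoothFn (jetDomain T 3) :=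
  der (vecX i) (shift i)

theorem der_zero_zero {E : Type*} [NormedAddCommGroup E] [NormedSpace ℝ E] {D : Opens E}
    (f : smoothFn D) : der 0 0 f = 0 := by
  ext z hz
  rw [der_apply (fun _ _ => rfl) hz]
  simp

theorem dVert_eq_zero {k l : ℕ} (h : k < l) (σ : Fin m) (f : smoothFn (jetDomain T 3)) :
    dVert k l σ f = 0 := by
  rw [dVert, coordVec_eq_zero (Or.inr h), der_zero_zero]

theorem dVert_comm (k l k' l' : ℕ) (σ ν : Fin m) (f : smoothFn (jetDomain T 3)) :
    dVert k l σ (dVert k' l' ν f) = dVert k' l' ν (dVert k l σ f) := by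
  rw [dVert, dVert, der_comm]
  simp [der_zero_zero]

theorem dVert_dCut (i : Fin 2) {k : ℕ} (hk : k < 3) (l : ℕ) (σ : Fin m)
    (f : smoothFn (jetDomain T 3)) :
    dVert (k + 1) (l + i) σ (dCut i f) = dCut i (dVert (k + 1) (l + i) σ f) + dVert k l σ f := by
  rw [dVert, dCut, der_comm, shift_coordVec i hk]
  simp [dVert]

theorem dVert_dCut_of_lt (i : Fin 2) {k l : ℕ} (h : k = 0 ∨ l < i) (σ : Fin m)
    (f : smoothFn (jetDomain T 3)) :
    dVert k l σ (dCut i f) = dCut i (dVert k l σ f) := by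
  rw [dVert, dCut, der_comm, shift_coordVec_of_lt i h]
  simp [der_zero_zero]

/-! ### Functions of second order -/

/-- `a` is the pullback to the third jet prolongation of the smooth function `f` of second
order. -/
def IsPullback (a : smoothFn (jetDomain T 3)) (f : JetCoords m 2 → ℝ) : Prop :=
  ContDiffOn ℝ ∞ f (jetDomain T 2) ∧ ∀ z ∈ jetDomain T 3, a.1 z = f (proj z)

theorem exists_isPullback {f : JetCoords m 2 → ℝ} (hf : ContDiffOn ℝ ∞ f (jetDomain T 2)) :
    ∃ a : smoothFn (jetDomain T 3), IsPullback a f :=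
  ⟨restr (fun z => f (proj z)) (hf.comp projL.contDiff.contDiffOn fun _ h => h), hf,
    fun _ hz => restr_apply _ hz⟩

section Pullback

variable {a b : smoothFn (jetDomain T 3)} {f g : JetCoords m 2 → ℝ}

theorem IsPullback.add (ha : IsPullback a f) (hb : IsPullback b g) :
    IsPullback (a + b) (fun z => f z + g z) :=
  ⟨ha.1.add hb.1, fun z hz => by simp [ha.2 z hz, hb.2 z hz]⟩

theorem IsPullback.sub (ha : IsPullback a f) (hb : IsPullback b g) :
    IsPullback (a - b) (fun z => f z - g z) :=
  ⟨ha.1.sub hb.1, fun z hz => by simp [ha.2 z hz, hb.2 z hz]⟩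

theorem IsPullback.smul (c : ℝ) (ha : IsPullback a f) :
    IsPullback (c • a) (fun z => c * f z) :=
  ⟨contDiffOn_const.mul ha.1, fun z hz => by simp [ha.2 z hz]⟩

theorem IsPullback.fderiv_eq (ha : IsPullback a f) {z : JetCoords m 3} (hz : z ∈ jetDomain T 3)
    (e : JetCoords m 3) (N : JetCoords m 3 →L[ℝ] JetCoords m 3) :
    (der e N a).1 z = fderiv ℝ f (proj z) (proj (affineField e N z)) := by
  rw [der_apply (fun w hw => ha.2 w hw) hz]
  have h1 : DifferentiableAt ℝ f (projL z) :=
    (ha.1.contDiffAt ((jetDomain T 2).isOpen.mem_nhds (proj_mem hz))).differentiableAt (by simp)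
  have h2 := h1.hasFDerivAt.comp z projL.hasFDerivAt
  exact congrArg (fun φ : JetCoords m 3 →L[ℝ] ℝ => φ (affineField e N z)) h2.fderiv

theorem IsPullback.vert (ha : IsPullback a f) (k l : ℕ) (σ : Fin m) :
    IsPullback (dVert k l σ a) (fun p => fderiv ℝ f p (coordVec k l σ)) :=
  ⟨contDiffOn_fderiv_apply (jetDomain T 2).isOpen ha.1 contDiffOn_const, fun z hz => by
    rw [dVert, ha.fderiv_eq hz, affineField_zero, proj_coordVec]⟩

theorem IsPullback.dY (ha : IsPullback a f) (σ : Fin m) :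
    IsPullback (dVert 0 0 σ a) (dY σ f) := by
  have h := ha.vert 0 0 σ
  simp only [← vecY_eq_coordVec (r := 2) 0 0 (by omega) (by omega)] at h
  exact h

theorem IsPullback.dY1 (ha : IsPullback a f) (j : Fin 2) (σ : Fin m) :
    IsPullback (dVert 1 j σ a) (dY1 j σ f) := by
  have h := ha.vert 1 j σ
  simp only [← vecY_eq_coordVec (r := 2) 1 j (by omega) (by omega)] at h
  exact h

theorem IsPullback.dY2 (ha : IsPullback a f) (i j : Fin 2) (σ : Fin m) :
    IsPullback ((if i = j then (1 : ℝ) else 1 / 2) • dVert 2 (i + j : ℕ) σ a)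
      (dY2 i j σ f) := by
  have h := (ha.vert 2 (i + j : ℕ) σ).smul (if i = j then (1 : ℝ) else 1 / 2)
  simp only [← vecY_eq_coordVec (r := 2) 2 (i + j : ℕ) (by omega) (by omega)] at h
  exact h

theorem IsPullback.cut_apply (ha : IsPullback a f) (i : Fin 2) {z : JetCoords m 3}
    (hz : z ∈ jetDomain T 3) : (dCut i a).1 z = formalD i f z := by
  rw [dCut, ha.fderiv_eq hz, ← cutVec_eq_affineField, proj_cutVec, formalD]

theorem IsPullback.vert_three (ha : IsPullback a f) (l : ℕ) (σ : Fin m) :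
    dVert 3 l σ a = 0 := by
  ext z hz
  rw [(ha.vert 3 l σ).2 z hz, coordVec_eq_zero (Or.inl (by omega))]
  simp

/-- On functions of first order, the formal derivative is the cut formal derivative. -/
theorem IsPullback.cut (ha : IsPullback a f) (h : ∀ l σ, dVert 2 l σ a = 0)
    (i : Fin 2) : IsPullback (dCut i a) (cutD i f) := by
  refine ⟨contDiffOn_fderiv_apply (jetDomain T 2).isOpen ha.1 ?_, fun z hz => ?_⟩
  · simp only [funext (cutVec_eq_affineField i)]
    exact (contDiff_affineField _ _).contDiffOn
  · have h0 (l : ℕ) (σ : Fin m) : fderiv ℝ f (proj z) (coordVec 2 l σ) = 0 := by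
      have h1 := (ha.vert 2 l σ).2 z hz
      rw [h] at h1
      exact h1.symm
    rw [ha.cut_apply i hz, formalD, formalVec_eq_cutVec_add, map_add, map_sum]
    simp [h0, cutD]

end Pullback

end Frame

/-! ### Identities for second-order Lagrange functions -/

section Identities

open TopologicalSpace (Opens)

variable {m : ℕ} {T : Opens ((Fin 2 → ℝ) × (Fin m → ℝ))}

theorem dVert_dCut_zero {k : ℕ} (hk : k < 3) (l : ℕ) (σ : Fin m) (f : smoothFn (jetDomain T 3)) :
    dVert (k + 1) l σ (dCut 0 f) = dCut 0 (dVert (k + 1) l σ f) + dVert k l σ f :=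
  dVert_dCut 0 hk l σ f

theorem dVert_dCut_one {k : ℕ} (hk : k < 3) (l : ℕ) (σ : Fin m) (f : smoothFn (jetDomain T 3)) :
    dVert (k + 1) (l + 1) σ (dCut 1 f) = dCut 1 (dVert (k + 1) (l + 1) σ f) + dVert k l σ f :=
  dVert_dCut 1 hk l σ f

theorem dVert_dCut_one_of_zero (k : ℕ) (σ : Fin m) (f : smoothFn (jetDomain T 3)) :
    dVert k 0 σ (dCut 1 f) = dCut 1 (dVert k 0 σ f) :=
  dVert_dCut_of_lt 1 (Or.inr (by simp)) σ f

/-- The functions `∂L/∂y^σ_j - d_i ∂L/∂y^σ_{ij}`. -/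
def momentum (F : smoothFn (jetDomain T 3)) (j : Fin 2) (σ : Fin m) : smoothFn (jetDomain T 3) :=
  -- `dVert 2 1` is the ordinary derivative in y_12, twice the symmetrized one; hence the factor
  -- 1/2.
  if j = 0 then dVert 1 0 σ F - dCut 0 (dVert 2 0 σ F) - (1 / 2 : ℝ) • dCut 1 (dVert 2 1 σ F)
  else dVert 1 1 σ F - (1 / 2 : ℝ) • dCut 0 (dVert 2 1 σ F) - dCut 1 (dVert 2 2 σ F)

theorem momentum_zero (F : smoothFn (jetDomain T 3)) (σ : Fin m) : momentum F 0 σ =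
    dVert 1 0 σ F - dCut 0 (dVert 2 0 σ F) - (1 / 2 : ℝ) • dCut 1 (dVert 2 1 σ F) := rfl

theorem momentum_one (F : smoothFn (jetDomain T 3)) (σ : Fin m) : momentum F 1 σ =
    dVert 1 1 σ F - (1 / 2 : ℝ) • dCut 0 (dVert 2 1 σ F) - dCut 1 (dVert 2 2 σ F) := rfl

/-- `F` is of second order and satisfies the order-reducibility condition. -/
structure OrderRelations (F : smoothFn (jetDomain T 3)) : Prop where
  three : ∀ l σ, dVert 3 l σ F = 0
  d00_00 : ∀ σ ν, dVert 2 0 σ (dVert 2 0 ν F) = 0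
  d00_01 : ∀ σ ν, dVert 2 0 σ (dVert 2 1 ν F) = 0
  d11_01 : ∀ σ ν, dVert 2 2 σ (dVert 2 1 ν F) = 0
  d11_11 : ∀ σ ν, dVert 2 2 σ (dVert 2 2 ν F) = 0
  -- The order condition has two mixed terms here, each with weight 1/4 in ordinary derivatives.
  d00_11 : ∀ σ ν, dVert 2 0 σ (dVert 2 2 ν F) = -(1 / 2 : ℝ) • dVert 2 1 σ (dVert 2 1 ν F)

namespace OrderRelations

variable {F : smoothFn (jetDomain T 3)}

theorem d01_00 (h : OrderRelations F) (σ ν : Fin m) : dVert 2 1 σ (dVert 2 0 ν F) = 0 := by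
  rw [dVert_comm, h.d00_01]

theorem d01_11 (h : OrderRelations F) (σ ν : Fin m) : dVert 2 1 σ (dVert 2 2 ν F) = 0 := by
  rw [dVert_comm, h.d11_01]

theorem d11_00 (h : OrderRelations F) (σ ν : Fin m) :
    dVert 2 2 σ (dVert 2 0 ν F) = -(1 / 2 : ℝ) • dVert 2 1 σ (dVert 2 1 ν F) := by
  rw [dVert_comm, h.d00_11, dVert_comm]

theorem three_vert (h : OrderRelations F)
    (l k' l' : ℕ) (σ ν : Fin m) : dVert 3 l σ (dVert k' l' ν F) = 0 := by
  rw [dVert_comm, h.three, map_zero]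

/-- The second derivatives in `y^σ_{12}`, `y^ν_{12}` are of first order. -/
theorem vert_two_hessian (h : OrderRelations F) (l : ℕ) (ρ σ ν : Fin m) :
    dVert 2 l ρ (dVert 2 1 σ (dVert 2 1 ν F)) = 0 := by
  match l with
  | 0 => rw [dVert_comm, h.d00_01, map_zero]
  | 1 =>
    -- Trading the pair (12, 12) for (11, 22) brings ∂/∂y_12 next to ∂/∂y_22, and that product
    -- annihilates `F`.
    have h1 : dVert 2 1 σ (dVert 2 1 ν F) = (-2 : ℝ) • dVert 2 0 σ (dVert 2 2 ν F) := by
      rw [h.d00_11]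
      module
    rw [h1, map_smul, dVert_comm, h.d01_11, map_zero, smul_zero]
  | 2 => rw [dVert_comm, h.d11_01, map_zero]
  | n + 3 => exact dVert_eq_zero (by omega) _ _

/-- Third-order coordinates enter the momenta only through the formal derivatives of ∂L/∂y_ij. Their
coefficients are combinations of second derivatives of L that the order condition makes zero. -/
theorem vert_three_momentum (h : OrderRelations F) (j : Fin 2) (l : ℕ) (ν σ : Fin m) :
    dVert 3 l ν (momentum F j σ) = 0 := by
  have hj : j = 0 ∨ j = 1 := by omega
  match l with
  | 0 =>
    rcases hj with rfl | rfl <;>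
    simp [momentum_zero, momentum_one, dVert_dCut_zero, dVert_dCut_one_of_zero, h.three_vert,
      h.d00_00, h.d00_01]
  | 1 =>
    have e1 := fun f : smoothFn (jetDomain T 3) => dVert_dCut_one (k := 2) (by omega) 0 ν f
    simp only [Nat.reduceAdd] at e1
    rcases hj with rfl | rfl
    · simp [momentum_zero, dVert_dCut_zero, e1, h.three_vert, h.d00_01, h.d01_00]
    · simp [momentum_one, dVert_dCut_zero, e1, h.three_vert, h.d00_11]
      module
  | 2 =>
    have e1 := fun f : smoothFn (jetDomain T 3) => dVert_dCut_one (k := 2) (by omega) 1 ν f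
    simp only [Nat.reduceAdd] at e1
    rcases hj with rfl | rfl
    · simp [momentum_zero, dVert_dCut_zero, e1, h.three_vert, h.d11_00]
      module
    · simp [momentum_one, dVert_dCut_zero, e1, h.three_vert, h.d11_01, h.d01_11]
  | 3 =>
    have e1 := fun f : smoothFn (jetDomain T 3) => dVert_dCut_one (k := 2) (by omega) 2 ν f
    simp only [Nat.reduceAdd] at e1
    have e2 := fun f : smoothFn (jetDomain T 3) => dVert_eq_zero (k := 2) (l := 3) (by omega) ν f
    rcases hj with rfl | rfl <;>
    simp [momentum_zero, momentum_one, dVert_dCut_zero, e1, e2, h.three_vert,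
      h.d11_01, h.d11_11]
  | n + 4 => exact dVert_eq_zero (by omega) _ _

/-- The vertical derivative is commuted past the cut ones, and the order relations reduce the second
derivatives in y_ij to those in y_12, y_12. This and the next three formulas yield the exchange
relations; the two for `momentum F 1` also prescribe Q. -/
theorem vert_two_zero_momentum_one (h : OrderRelations F)
    (σ ν : Fin m) : dVert 2 0 σ (momentum F 1 ν) =
    dVert 1 1 ν (dVert 2 0 σ F) - (1 / 2 : ℝ) • dVert 1 0 σ (dVert 2 1 ν F)
      + (1 / 2 : ℝ) • dCut 1 (dVert 2 1 σ (dVert 2 1 ν F)) := by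
  rw [momentum_one, map_sub, map_sub, map_smul, dVert_dCut_zero (by omega),
    dVert_dCut_one_of_zero, h.d00_01, h.d00_11, map_smul, map_zero,
    dVert_comm 2 0 1 1]
  module

theorem vert_two_one_momentum_one (h : OrderRelations F)
    (σ ν : Fin m) : dVert 2 1 σ (momentum F 1 ν) =
    dVert 1 1 ν (dVert 2 1 σ F) - (1 / 2 : ℝ) • dCut 0 (dVert 2 1 σ (dVert 2 1 ν F))
      - (1 / 2 : ℝ) • dVert 1 1 σ (dVert 2 1 ν F) - dVert 1 0 σ (dVert 2 2 ν F) := by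
  rw [momentum_one, map_sub, map_sub, map_smul, dVert_dCut_zero (by omega),
    dVert_dCut_one (by omega), h.d01_11, map_zero, dVert_comm 2 1 1 1]
  module

theorem vert_two_one_momentum_zero (h : OrderRelations F)
    (σ ν : Fin m) : dVert 2 1 σ (momentum F 0 ν) =
    dVert 1 0 ν (dVert 2 1 σ F) - dVert 1 1 σ (dVert 2 0 ν F)
      - (1 / 2 : ℝ) • dCut 1 (dVert 2 1 σ (dVert 2 1 ν F))
      - (1 / 2 : ℝ) • dVert 1 0 σ (dVert 2 1 ν F) := by
  rw [momentum_zero, map_sub, map_sub, map_smul, dVert_dCut_zero (by omega),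
    dVert_dCut_one (by omega), h.d01_00, map_zero, dVert_comm 2 1 1 0]
  module

theorem vert_two_two_momentum_zero (h : OrderRelations F)
    (σ ν : Fin m) : dVert 2 2 σ (momentum F 0 ν) =
    dVert 1 0 ν (dVert 2 2 σ F) + (1 / 2 : ℝ) • dCut 0 (dVert 2 1 σ (dVert 2 1 ν F))
      - (1 / 2 : ℝ) • dVert 1 1 σ (dVert 2 1 ν F) := by
  rw [momentum_zero, map_sub, map_sub, map_smul, dVert_dCut_zero (by omega),
    dVert_dCut_one (by omega), h.d11_00, h.d11_01, map_smul, map_zero,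
    dVert_comm 2 2 1 0, dVert_eq_zero (k := 1) (l := 2) (by omega)]
  module

end OrderRelations

/-- The Lagrange function `F` of second order is variationally trivial and satisfies the
order-reducibility condition. -/
structure TrivialRelations (F : smoothFn (jetDomain T 3)) : Prop extends OrderRelations F where
  -- The cut derivatives lose nothing here, because the momenta are of second order.
  euler : ∀ σ, dVert 0 0 σ F = dCut 0 (momentum F 0 σ) + dCut 1 (momentum F 1 σ)

namespace TrivialRelations

variable {F : smoothFn (jetDomain T 3)}

/-- Differentiate the Euler–Lagrange equation in a third-order coordinate. Neither `F` nor the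
momenta depend on it, so only the commutators with the two cut derivatives survive. -/
theorem vert_two_momentum (h : TrivialRelations F) (l : ℕ) (ν σ : Fin m) :
    dVert 2 (l + 1) ν (momentum F 0 σ) + dVert 2 l ν (momentum F 1 σ) = 0 := by
  have h1 := congrArg (dVert 3 (l + 1) ν) (h.euler σ)
  rw [dVert_comm, h.three, map_zero, map_add, dVert_dCut_zero (by omega),
    dVert_dCut_one (by omega), h.vert_three_momentum, h.vert_three_momentum] at h1
  simpa using h1.symm

/-- In the case `l = 0` of `vert_two_momentum` the derivatives of the second derivatives in y_12,
y_12 cancel. The resulting relation, with its companion `exchange_one`, carries what triviality adds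
to the order condition at the level of second derivatives of L. -/
theorem exchange_zero (h : TrivialRelations F) (σ ν : Fin m) :
    dVert 1 0 σ (dVert 2 1 ν F) - dVert 1 0 ν (dVert 2 1 σ F)
      + dVert 1 1 σ (dVert 2 0 ν F) - dVert 1 1 ν (dVert 2 0 σ F) = 0 := by
  have h1 := h.vert_two_momentum 0 ν σ
  rw [h.vert_two_one_momentum_zero, h.vert_two_zero_momentum_one] at h1
  rw [← h1]
  module

theorem exchange_one (h : TrivialRelations F) (σ ν : Fin m) :
    dVert 1 1 σ (dVert 2 1 ν F) - dVert 1 1 ν (dVert 2 1 σ F)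
      + dVert 1 0 σ (dVert 2 2 ν F) - dVert 1 0 ν (dVert 2 2 σ F) = 0 := by
  have h1 := h.vert_two_momentum 1 ν σ
  rw [h.vert_two_two_momentum_zero, h.vert_two_one_momentum_one] at h1
  rw [← h1]
  module

/-- The skew-symmetric parts of the mixed derivatives in `y^σ_j`, `y^ν_{12}` are of first
order. -/
theorem vert_two_skew (h : TrivialRelations F) (j : Fin 2) (l : ℕ) (ρ σ ν : Fin m) :
    dVert 2 l ρ (dVert 1 j σ (dVert 2 1 ν F) - dVert 1 j ν (dVert 2 1 σ F)) = 0 := by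
  match l with
  | 0 =>
    rw [map_sub, dVert_comm, h.d00_01, dVert_comm, h.d00_01]
    simp
  | 1 =>
    have hj : j = 0 ∨ j = 1 := by omega
    rcases hj with rfl | rfl
    -- Differentiating the exchange relation in y_12 kills its terms containing ∂/∂y_11 and leaves
    -- the claim.
    · have h1 := congrArg (dVert 2 1 ρ) (h.exchange_zero σ ν)
      rw [map_sub, map_add, dVert_comm 2 1 1 1, dVert_comm 2 1 1 1, h.d01_00, h.d01_00] at h1
      simpa using h1
    · have h1 := congrArg (dVert 2 1 ρ) (h.exchange_one σ ν)
      rw [map_sub, map_add, dVert_comm 2 1 1 0, dVert_comm 2 1 1 0, h.d01_11, h.d01_11] at h1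
      simpa using h1
  | 2 =>
    rw [map_sub, dVert_comm, h.d11_01, dVert_comm, h.d11_01]
    simp
  | n + 3 => exact dVert_eq_zero (by omega) _ _

end TrivialRelations

/-- The coefficients `P_{σν}` of the fundamental form, with formal derivatives in place of the cut
ones. -/
def lepageP (F : smoothFn (jetDomain T 3)) (σ ν : Fin m) : smoothFn (jetDomain T 3) :=
  (1 / 2 : ℝ) • (dVert 1 0 σ (dVert 1 1 ν F) - dVert 1 0 ν (dVert 1 1 σ F))
    + (1 / 2 : ℝ) • dCut 0 (dVert 1 0 ν (dVert 2 1 σ F) - dVert 1 0 σ (dVert 2 1 ν F))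
    + (1 / 2 : ℝ) • dCut 1 (dVert 1 1 σ (dVert 2 1 ν F) - dVert 1 1 ν (dVert 2 1 σ F))

/-- The coefficients `Q^j_{σ,ν}` of the fundamental form, with formal derivatives in place of the
cut ones. -/
def lepageQ (F : smoothFn (jetDomain T 3)) (j : Fin 2) (σ ν : Fin m) : smoothFn (jetDomain T 3) :=
  if j = 0 then
    dVert 1 0 σ (dVert 2 1 ν F) - (1 / 2 : ℝ) • dVert 1 0 ν (dVert 2 1 σ F)
      - dVert 1 1 ν (dVert 2 0 σ F) - (1 / 2 : ℝ) • dCut 1 (dVert 2 1 σ (dVert 2 1 ν F))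
  else
    -dVert 1 1 σ (dVert 2 1 ν F) + dVert 1 0 ν (dVert 2 2 σ F)
      + (1 / 2 : ℝ) • dVert 1 1 ν (dVert 2 1 σ F)
      + (1 / 2 : ℝ) • dCut 0 (dVert 2 1 σ (dVert 2 1 ν F))

/-- The coefficients `R^{i,j}_{σ,ν}` of the fundamental form. -/
def lepageR (F : smoothFn (jetDomain T 3)) (i j : Fin 2) (σ ν : Fin m) :
    smoothFn (jetDomain T 3) :=
  if i = j then 0
  else if i = 0 then -(1 / 2 : ℝ) • dVert 2 1 σ (dVert 2 1 ν F)
  else (1 / 2 : ℝ) • dVert 2 1 σ (dVert 2 1 ν F)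

theorem lepageQ_zero (F : smoothFn (jetDomain T 3)) (σ ν : Fin m) : lepageQ F 0 σ ν =
    dVert 1 0 σ (dVert 2 1 ν F) - (1 / 2 : ℝ) • dVert 1 0 ν (dVert 2 1 σ F)
      - dVert 1 1 ν (dVert 2 0 σ F) - (1 / 2 : ℝ) • dCut 1 (dVert 2 1 σ (dVert 2 1 ν F)) := rfl

theorem lepageQ_one (F : smoothFn (jetDomain T 3)) (σ ν : Fin m) : lepageQ F 1 σ ν =
    -dVert 1 1 σ (dVert 2 1 ν F) + dVert 1 0 ν (dVert 2 2 σ F)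
      + (1 / 2 : ℝ) • dVert 1 1 ν (dVert 2 1 σ F)
      + (1 / 2 : ℝ) • dCut 0 (dVert 2 1 σ (dVert 2 1 ν F)) := rfl

namespace TrivialRelations

variable {F : smoothFn (jetDomain T 3)}

/-- Up to sign, this is the component of dZ on E_0, ∂/∂y_11, ∂/∂y; it dictates the choice of Q^1.
The next lemma does the same for ∂/∂y_12 and Q^2, without an exchange relation. -/
theorem vert_two_zero_momentum_add_lepageQ (h : TrivialRelations F) (σ ν : Fin m) :
    dVert 2 0 σ (momentum F 1 ν) + lepageQ F 0 ν σ = 0 := by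
  rw [h.vert_two_zero_momentum_one, lepageQ_zero, dVert_comm 2 1 2 1 ν σ, ← h.exchange_zero ν σ]
  module

theorem vert_two_one_momentum_add_lepageQ (h : TrivialRelations F) (σ ν : Fin m) :
    dVert 2 1 σ (momentum F 1 ν) + lepageQ F 1 ν σ = 0 := by
  rw [h.vert_two_one_momentum_one, lepageQ_one, dVert_comm 2 1 2 1 ν σ]
  module

/-- Needed for the component of dZ on E_0 and two vectors ∂/∂y_1, to which R contributes nothing. -/
theorem lepageQ_zero_skew (h : TrivialRelations F) (σ ν : Fin m) :
    lepageQ F 0 σ ν - lepageQ F 0 ν σ = (1 / 2 : ℝ) • dVert 1 0 σ (dVert 2 1 ν F)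
      - (1 / 2 : ℝ) • dVert 1 0 ν (dVert 2 1 σ F) := by
  rw [lepageQ_zero, lepageQ_zero, dVert_comm 2 1 2 1 ν σ, ← sub_eq_zero, ← h.exchange_zero σ ν]
  module

/-- Each side is the component of dZ on E_0, ∂/∂y_1, ∂/∂y, with σ and ν exchanged. Their difference
is d_1 of one exchange relation plus d_2 of the other. -/
theorem lepageP_eq (h : TrivialRelations F) (σ ν : Fin m) :
    lepageP F σ ν - dCut 0 (lepageQ F 0 ν σ) - dVert 1 0 σ (momentum F 1 ν)
      + (1 / 2 : ℝ) • dVert 0 0 ν (dVert 2 1 σ F) =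
    lepageP F ν σ - dCut 0 (lepageQ F 0 σ ν) - dVert 1 0 ν (momentum F 1 σ)
      + (1 / 2 : ℝ) • dVert 0 0 σ (dVert 2 1 ν F) := by
  have h0 := congrArg (dCut 0) (h.exchange_zero σ ν)
  have h1 := congrArg (dCut 1) (h.exchange_one σ ν)
  simp only [map_sub, map_add, map_zero] at h0 h1
  simp only [lepageP, lepageQ_zero, momentum_one, map_sub, map_smul,
    dVert_dCut_zero (k := 0) (by omega), dVert_dCut_one_of_zero, dVert_comm 2 1 2 1 ν σ]
  linear_combination (norm := module) h0 + h1

end TrivialRelations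

end Identities

/-! ### Closed forms in the adapted frame -/

section ClosedForms

open TopologicalSpace (Opens)

variable {m : ℕ} {T : Opens ((Fin 2 → ℝ) × (Fin m → ℝ))}

theorem form_two_eq_zero_of_frame {r : ℕ} (z : JetCoords m r)
    (α : JetCoords m r [⋀^Fin 2]→L[ℝ] ℝ) (u : JetCoords m r)
    (hE : ∀ i, α ![u, cutVec i z] = 0) (hv : ∀ k l σ, α ![u, coordVec k l σ] = 0)
    (v : JetCoords m r) : α ![u, v] = 0 := by
  have key (w) : α.toMultilinearMap.toLinearMap ![u, 0] 1 w = α ![u, w] := by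
    refine congrArg α (funext fun i => ?_)
    fin_cases i <;> rfl
  rw [← key, linearMap_eq_zero_of_frame z (α.toMultilinearMap.toLinearMap ![u, 0] 1)
    (fun i => (key _).trans (hE i)) (fun k l σ => (key _).trans (hv k l σ))]
  rfl

theorem form_three_eq_zero_of_frame {r : ℕ} (z : JetCoords m r)
    (α : JetCoords m r [⋀^Fin 3]→L[ℝ] ℝ) (u v : JetCoords m r)
    (hE : ∀ i, α ![u, v, cutVec i z] = 0) (hv : ∀ k l σ, α ![u, v, coordVec k l σ] = 0)
    (w : JetCoords m r) : α ![u, v, w] = 0 := by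
  have key (w) : α.toMultilinearMap.toLinearMap ![u, v, 0] 2 w = α ![u, v, w] := by
    refine congrArg α (funext fun i => ?_)
    fin_cases i <;> rfl
  rw [← key, linearMap_eq_zero_of_frame z (α.toMultilinearMap.toLinearMap ![u, v, 0] 2)
    (fun i => (key _).trans (hE i)) (fun k l σ => (key _).trans (hv k l σ))]
  rfl

theorem form_three_self_left {r : ℕ} (α : JetCoords m r [⋀^Fin 3]→L[ℝ] ℝ) (u v : JetCoords m r) :
    α ![u, u, v] = 0 := by
  have := form_three_swap α u u v
  linarith

theorem form_three_self_right {r : ℕ} (α : JetCoords m r [⋀^Fin 3]→L[ℝ] ℝ)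
    (u v : JetCoords m r) : α ![u, v, v] = 0 := by
  have := form_three_swap_right α u v v
  linarith

theorem form_three_contraction_eq_zero {r : ℕ} (z : JetCoords m r)
    (α : JetCoords m r [⋀^Fin 3]→L[ℝ] ℝ) (u : JetCoords m r)
    (hEE : α ![u, cutVec 0 z, cutVec 1 z] = 0)
    (hE : ∀ i k l σ, α ![u, cutVec i z, coordVec k l σ] = 0)
    (hv : ∀ k l σ k' l' ν, α ![u, coordVec k l σ, coordVec k' l' ν] = 0)
    (v w : JetCoords m r) : α ![u, v, w] = 0 := by
  have hEE' (i j) : α ![u, cutVec i z, cutVec j z] = 0 := by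
    have hi : i = 0 ∨ i = 1 := by omega
    have hj : j = 0 ∨ j = 1 := by omega
    rcases hi with rfl | rfl <;> rcases hj with rfl | rfl
    · exact form_three_self_right ..
    · exact hEE
    · rw [form_three_swap_right, hEE, neg_zero]
    · exact form_three_self_right ..
  have h1 (i) (w) : α ![u, cutVec i z, w] = 0 :=
    form_three_eq_zero_of_frame z α _ _ (hEE' i) (hE i) w
  have h2 (k l σ) (w) : α ![u, coordVec k l σ, w] = 0 :=
    form_three_eq_zero_of_frame z α _ _
      (fun i => by rw [form_three_swap_right, hE, neg_zero]) (hv k l σ) w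
  refine form_three_eq_zero_of_frame z α _ _ (fun i => ?_) (fun k l σ => ?_) w
  · rw [form_three_swap_right, h1, neg_zero]
  · rw [form_three_swap_right, h2, neg_zero]

/-- A property of all vertical coordinate vectors is checked order by order. -/
theorem coordVec_cases {p : JetCoords m 3 → Prop} (σ : Fin m) (h00 : p (coordVec 0 0 σ))
    (h10 : p (coordVec 1 0 σ)) (h11 : p (coordVec 1 1 σ)) (h20 : p (coordVec 2 0 σ))
    (h21 : p (coordVec 2 1 σ)) (h22 : p (coordVec 2 2 σ)) (h3 : ∀ l, p (coordVec 3 l σ))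
    (k l : ℕ) : p (coordVec k l σ) := by
  have h0 : p 0 := by
    -- No third-order multi-index has four entries 2, so `h3 4` is a statement about the zero
    -- vector.
    rw [← coordVec_eq_zero (r := 3) (k := 3) (l := 4) (Or.inr (by omega)) σ]
    exact h3 4
  match k, l with
  | 0, 0 => exact h00
  | 1, 0 => exact h10
  | 1, 1 => exact h11
  | 2, 0 => exact h20
  | 2, 1 => exact h21
  | 2, 2 => exact h22
  | 3, l => exact h3 l
  | 0, l + 1 => rwa [coordVec_eq_zero (Or.inr (by omega))]
  | 1, l + 2 => rwa [coordVec_eq_zero (Or.inr (by omega))]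
  | 2, l + 3 => rwa [coordVec_eq_zero (Or.inr (by omega))]
  | k + 4, l => rwa [coordVec_eq_zero (Or.inl (by omega))]

theorem shift_zero_coordVec {k : ℕ} (hk : k < 3) (l : ℕ) (σ : Fin m) :
    shift 0 (coordVec (k + 1) l σ : JetCoords m 3) = coordVec k l σ :=
  shift_coordVec 0 hk σ

theorem shift_one_coordVec {k : ℕ} (hk : k < 3) (l : ℕ) (σ : Fin m) :
    shift 1 (coordVec (k + 1) (l + 1) σ : JetCoords m 3) = coordVec k l σ :=
  shift_coordVec 1 hk σ

theorem shift_one_coordVec_zero (k : ℕ) (σ : Fin m) :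
    shift 1 (coordVec k 0 σ : JetCoords m 3) = 0 :=
  shift_coordVec_of_lt 1 (Or.inr (by simp)) σ

theorem shift_coordVec_zero (i : Fin 2) (l : ℕ) (σ : Fin m) :
    shift i (coordVec 0 l σ : JetCoords m 3) = 0 :=
  shift_coordVec_of_lt i (Or.inl rfl) σ

/-- Only the order of the result matters, since the 2-form is annihilated by every vertical vector
of order two. The witness 3 below stands for the zero vector. -/
theorem shift_coordVec_three (i : Fin 2) (l : ℕ) (σ : Fin m) :
    ∃ l', shift i (coordVec 3 l σ : JetCoords m 3) = coordVec 2 l' σ := by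
  have hi : i = 0 ∨ i = 1 := by omega
  rcases hi with rfl | rfl
  · exact ⟨l, shift_zero_coordVec (by omega) l σ⟩
  · cases l with
    | zero => exact ⟨3, by rw [shift_one_coordVec_zero, coordVec_eq_zero (Or.inr (by omega))]⟩
    | succ l => exact ⟨l, shift_one_coordVec (by omega) l σ⟩

/-! ### 2-forms described by their values on the adapted frame. -/

/-- The values of a Lepage form on `cutVec i` and a vertical coordinate vector. -/
def baseTable (F : smoothFn (jetDomain T 3)) (i : Fin 2) (k l : ℕ) (σ : Fin m) :
    smoothFn (jetDomain T 3) :=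
  -- On (E_i, vertical), ω^σ ∧ ω_j gives -ω_j(E_i) times the vertical component. As ω_1 = dx² and
  -- ω_2 = -dx¹, base indices cross over and the signs differ for the two E_i.
  match i, k, l with
  | 0, 0, 0 => momentum F 1 σ
  | 0, 1, 0 => (1 / 2 : ℝ) • dVert 2 1 σ F
  | 0, 1, 1 => dVert 2 2 σ F
  | 1, 0, 0 => -momentum F 0 σ
  | 1, 1, 0 => -dVert 2 0 σ F
  | 1, 1, 1 => -(1 / 2 : ℝ) • dVert 2 1 σ F
  | _, _, _ => 0

/-- The values of a Lepage form on two vertical coordinate vectors. -/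
def vertTable (P : Fin m → Fin m → smoothFn (jetDomain T 3))
    (Q : Fin 2 → Fin m → Fin m → smoothFn (jetDomain T 3))
    (R : Fin 2 → Fin 2 → Fin m → Fin m → smoothFn (jetDomain T 3))
    (k l : ℕ) (σ : Fin m) (k' l' : ℕ) (ν : Fin m) : smoothFn (jetDomain T 3) :=
  match k, l, k', l' with
  | 0, 0, 0, 0 => P σ ν
  | 0, 0, 1, 0 => Q 0 σ ν
  | 0, 0, 1, 1 => Q 1 σ ν
  | 1, 0, 0, 0 => -Q 0 ν σ
  | 1, 1, 0, 0 => -Q 1 ν σ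
  | 1, 0, 1, 0 => R 0 0 σ ν
  | 1, 0, 1, 1 => R 0 1 σ ν
  | 1, 1, 1, 0 => R 1 0 σ ν
  | 1, 1, 1, 1 => R 1 1 σ ν
  | _, _, _, _ => 0

/-- The 2-form `η` has the given values on the adapted frame. -/
structure FormTable (η : JetCoords m 3 → JetCoords m 3 [⋀^Fin 2]→L[ℝ] ℝ)
    (F : smoothFn (jetDomain T 3))
    (P : Fin m → Fin m → smoothFn (jetDomain T 3))
    (Q : Fin 2 → Fin m → Fin m → smoothFn (jetDomain T 3))
    (R : Fin 2 → Fin 2 → Fin m → Fin m → smoothFn (jetDomain T 3)) : Prop where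
  smooth : ContDiffOn ℝ ∞ η (jetDomain T 3)
  base : ∀ z ∈ jetDomain T 3, η z ![cutVec 0 z, cutVec 1 z] = F.1 z
  mixed : ∀ z ∈ jetDomain T 3, ∀ i k l σ,
    η z ![cutVec i z, coordVec k l σ] = (baseTable F i k l σ).1 z
  vert : ∀ z ∈ jetDomain T 3, ∀ k l σ k' l' ν,
    η z ![coordVec k l σ, coordVec k' l' ν] = (vertTable P Q R k l σ k' l' ν).1 z

namespace FormTable

variable {η : JetCoords m 3 → JetCoords m 3 [⋀^Fin 2]→L[ℝ] ℝ} {F : smoothFn (jetDomain T 3)}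
  {P : Fin m → Fin m → smoothFn (jetDomain T 3)}
  {Q : Fin 2 → Fin m → Fin m → smoothFn (jetDomain T 3)}
  {R : Fin 2 → Fin 2 → Fin m → Fin m → smoothFn (jetDomain T 3)}

theorem differentiableAt (h : FormTable η F P Q R)
    {z : JetCoords m 3} (hz : z ∈ jetDomain T 3) : DifferentiableAt ℝ η z :=
  (h.smooth.contDiffAt ((jetDomain T 3).isOpen.mem_nhds hz)).differentiableAt (by simp)

/-- Cartan's formula: the two undifferentiated terms come from the brackets of the vertical vector
with E_0 and E_1, while [E_0, E_1] contributes nothing. -/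
theorem extDeriv_base (h : FormTable η F P Q R)
    {z : JetCoords m 3} (hz : z ∈ jetDomain T 3) (k l : ℕ) (σ : Fin m) :
    extDeriv η z ![cutVec 0 z, cutVec 1 z, coordVec k l σ] =
      (dCut 0 (baseTable F 1 k l σ) - dCut 1 (baseTable F 0 k l σ) + dVert k l σ F).1 z
        + η z ![cutVec 1 z, shift 0 (coordVec k l σ)]
        - η z ![cutVec 0 z, shift 1 (coordVec k l σ)] := by
  have h1 := extDeriv_affineField (h.differentiableAt hz) hz
    (e₀ := vecX 0) (e₁ := vecX 1) (e₂ := coordVec k l σ) (N₀ := shift 0) (N₁ := shift 1) (N₂ := 0)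
    (f₀ := baseTable F 1 k l σ) (f₁ := baseTable F 0 k l σ) (f₂ := F)
    (fun z hz => by simpa [cutVec_eq_affineField] using (h.mixed z hz 1 k l σ).symm)
    (fun z hz => by simpa [cutVec_eq_affineField] using (h.mixed z hz 0 k l σ).symm)
    (fun z hz => by simpa [cutVec_eq_affineField] using (h.base z hz).symm)
  have hc : shift 1 (affineField (vecX 0) (shift 0) z) =
      shift 0 (affineField (vecX 1) (shift 1) z) := by
    simp [affineField, shift_vecX, shift_shift 1 0]
  have h0 (v : JetCoords m 3) : η z ![0, v] = 0 := (η z).map_coord_zero 0 rfl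
  rw [hc] at h1
  simp only [affineField_zero, ← cutVec_eq_affineField, zero_apply, h0] at h1
  rw [h1, form_two_swap _ (cutVec 1 z), form_two_swap _ (cutVec 0 z) (shift 1 _)]
  simp only [dCut, dVert]
  ring

theorem extDeriv_mixed (h : FormTable η F P Q R)
    {z : JetCoords m 3} (hz : z ∈ jetDomain T 3) (i : Fin 2) (k l : ℕ)
    (σ : Fin m) (k' l' : ℕ) (ν : Fin m) :
    extDeriv η z ![cutVec i z, coordVec k l σ, coordVec k' l' ν] =
      (dCut i (vertTable P Q R k l σ k' l' ν) - dVert k l σ (baseTable F i k' l' ν)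
          + dVert k' l' ν (baseTable F i k l σ)).1 z
        + η z ![shift i (coordVec k l σ), coordVec k' l' ν]
        - η z ![shift i (coordVec k' l' ν), coordVec k l σ] := by
  have h1 := extDeriv_affineField (h.differentiableAt hz) hz
    (e₀ := vecX i) (e₁ := coordVec k l σ) (e₂ := coordVec k' l' ν)
    (N₀ := shift i) (N₁ := 0) (N₂ := 0)
    (f₀ := vertTable P Q R k l σ k' l' ν) (f₁ := baseTable F i k' l' ν)
    (f₂ := baseTable F i k l σ)
    (fun z hz => by simpa using (h.vert z hz k l σ k' l' ν).symm)
    (fun z hz => by simpa [cutVec_eq_affineField] using (h.mixed z hz i k' l' ν).symm)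
    (fun z hz => by simpa [cutVec_eq_affineField] using (h.mixed z hz i k l σ).symm)
  have h0 (v : JetCoords m 3) : η z ![0, v] = 0 := (η z).map_coord_zero 0 rfl
  simp only [affineField_zero, ← cutVec_eq_affineField, zero_apply, h0] at h1
  rw [h1]
  simp only [dCut, dVert]
  ring

theorem extDeriv_vert (h : FormTable η F P Q R)
    {z : JetCoords m 3} (hz : z ∈ jetDomain T 3) (k l : ℕ) (σ : Fin m)
    (k' l' : ℕ) (ν : Fin m) (k'' l'' : ℕ) (ρ : Fin m) :
    extDeriv η z ![coordVec k l σ, coordVec k' l' ν, coordVec k'' l'' ρ] =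
      (dVert k l σ (vertTable P Q R k' l' ν k'' l'' ρ)
        - dVert k' l' ν (vertTable P Q R k l σ k'' l'' ρ)
        + dVert k'' l'' ρ (vertTable P Q R k l σ k' l' ν)).1 z := by
  have h1 := extDeriv_affineField (h.differentiableAt hz) hz
    (e₀ := coordVec k l σ) (e₁ := coordVec k' l' ν) (e₂ := coordVec k'' l'' ρ)
    (N₀ := 0) (N₁ := 0) (N₂ := 0)
    (f₀ := vertTable P Q R k' l' ν k'' l'' ρ) (f₁ := vertTable P Q R k l σ k'' l'' ρ)
    (f₂ := vertTable P Q R k l σ k' l' ν)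
    (fun z hz => by simpa using (h.vert z hz k' l' ν k'' l'' ρ).symm)
    (fun z hz => by simpa using (h.vert z hz k l σ k'' l'' ρ).symm)
    (fun z hz => by simpa using (h.vert z hz k l σ k' l' ν).symm)
  have h0 (v : JetCoords m 3) : η z ![0, v] = 0 := (η z).map_coord_zero 0 rfl
  simp only [affineField_zero, zero_apply, h0] at h1
  rw [h1]
  simp only [dVert]
  ring

/-- The tables have no entries of order above one, as the forms ω^σ, ω^σ_j and dx^i all vanish on
these vectors. -/
theorem vert_two_left (h : FormTable η F P Q R)
    {z : JetCoords m 3} (hz : z ∈ jetDomain T 3) (l : ℕ) (σ : Fin m)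
    (v : JetCoords m 3) : η z ![coordVec 2 l σ, v] = 0 := by
  refine form_two_eq_zero_of_frame z _ _ (fun i => ?_) (fun k' l' ν => ?_) v
  · rw [form_two_swap, h.mixed z hz]
    simp [baseTable]
  · rw [h.vert z hz]
    simp [vertTable]

theorem vert_three_left (h : FormTable η F P Q R)
    {z : JetCoords m 3} (hz : z ∈ jetDomain T 3) (l : ℕ) (σ : Fin m)
    (v : JetCoords m 3) : η z ![coordVec 3 l σ, v] = 0 := by
  refine form_two_eq_zero_of_frame z _ _ (fun i => ?_) (fun k' l' ν => ?_) v
  · rw [form_two_swap, h.mixed z hz]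
    simp [baseTable]
  · rw [h.vert z hz]
    simp [vertTable]

theorem contDiffAt_extDeriv (h : FormTable η F P Q R) {z : JetCoords m 3} (hz : z ∈ jetDomain T 3) :
    ContDiffAt ℝ ∞ (extDeriv η) z := by
  have h1 := (h.smooth.contDiffAt ((jetDomain T 3).isOpen.mem_nhds hz)).fderiv_right
    (m := ∞) (by simp)
  exact (ContinuousAlternatingMap.alternatizeUncurryFinCLM ℝ (JetCoords m 3) ℝ
    (n := 2)).contDiff.contDiffAt.comp z h1

theorem extDeriv_extDeriv_eq_zero (h : FormTable η F P Q R)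
    {z : JetCoords m 3} (hz : z ∈ jetDomain T 3) :
    extDeriv (extDeriv η) z = 0 :=
  extDeriv_extDeriv_apply (h.smooth.contDiffAt ((jetDomain T 3).isOpen.mem_nhds hz))
    (by rw [minSmoothness_of_isRCLikeNormedField]
        exact WithTop.coe_le_coe.2 (le_top : (2 : ℕ∞) ≤ ⊤))

end FormTable

end ClosedForms

/-! ### Closedness of the fundamental form of a trivial Lagrangian -/

section Closedness

open TopologicalSpace (Opens)

variable {m : ℕ} {T : Opens ((Fin 2 → ℝ) × (Fin m → ℝ))} {F : smoothFn (jetDomain T 3)}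

theorem vert_three_dCut {f : smoothFn (jetDomain T 3)} (h3 : ∀ l ρ, dVert 3 l ρ f = 0)
    (h2 : ∀ l ρ, dVert 2 l ρ f = 0) (i : Fin 2) (l : ℕ) (ρ : Fin m) :
    dVert 3 l ρ (dCut i f) = 0 := by
  have hi : i = 0 ∨ i = 1 := by omega
  rcases hi with rfl | rfl
  · rw [dVert_dCut_zero (by omega), h3, h2, map_zero, add_zero]
  · cases l with
    | zero => rw [dVert_dCut_one_of_zero, h3, map_zero]
    | succ l => rw [dVert_dCut_one (by omega), h3, h2, map_zero, add_zero]

theorem OrderRelations.three_vert_vert (h : OrderRelations F) (l k k' l' l'' : ℕ) (ρ σ ν : Fin m) :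
    dVert 3 l ρ (dVert k l' σ (dVert k' l'' ν F)) = 0 := by
  rw [dVert_comm, h.three_vert, map_zero]

theorem OrderRelations.vert_three_baseTable (h : OrderRelations F) (l : ℕ) (ρ : Fin m)
    (i : Fin 2) (k' l' : ℕ) (σ : Fin m) : dVert 3 l ρ (baseTable F i k' l' σ) = 0 := by
  unfold baseTable
  split <;> simp [h.vert_three_momentum, h.three_vert]

/-- The functions differentiated in P are of first order by `vert_two_skew`, so their formal
derivatives are of second order. For Q, `vert_two_hessian` plays this role. -/
theorem TrivialRelations.vert_three_lepageP (h : TrivialRelations F) (l : ℕ) (ρ σ ν : Fin m) :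
    dVert 3 l ρ (lepageP F σ ν) = 0 := by
  have h3 (k l' : ℕ) (σ ν : Fin m) (l ρ) :
      dVert 3 l ρ (dVert 1 k σ (dVert 2 l' ν F) - dVert 1 k ν (dVert 2 l' σ F)) = 0 := by
    rw [map_sub, h.three_vert_vert, h.three_vert_vert, sub_zero]
  rw [lepageP, map_add, map_add, map_smul, map_smul, map_smul, map_sub, h.three_vert_vert,
    h.three_vert_vert, vert_three_dCut (h3 0 1 ν σ) (fun l ρ => h.vert_two_skew 0 l ρ ν σ),
    vert_three_dCut (h3 1 1 σ ν) (fun l ρ => h.vert_two_skew 1 l ρ σ ν)]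
  simp

theorem OrderRelations.vert_three_lepageQ (h : OrderRelations F) (l : ℕ) (ρ : Fin m) (j : Fin 2)
    (σ ν : Fin m) : dVert 3 l ρ (lepageQ F j σ ν) = 0 := by
  have hc (i : Fin 2) : dVert 3 l ρ (dCut i (dVert 2 1 σ (dVert 2 1 ν F))) = 0 :=
    vert_three_dCut (fun l ρ => h.three_vert_vert ..) (fun l ρ => h.vert_two_hessian ..) i l ρ
  unfold lepageQ
  split <;> simp [h.three_vert_vert, hc]

theorem OrderRelations.vert_three_lepageR (h : OrderRelations F) (l : ℕ) (ρ : Fin m)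
    (i j : Fin 2) (σ ν : Fin m) : dVert 3 l ρ (lepageR F i j σ ν) = 0 := by
  unfold lepageR
  split_ifs <;> simp [h.three_vert_vert]

theorem TrivialRelations.vert_three_vertTable (h : TrivialRelations F) (l : ℕ) (ρ : Fin m)
    (k' l' : ℕ) (σ : Fin m) (k'' l'' : ℕ) (ν : Fin m) :
    dVert 3 l ρ (vertTable (lepageP F) (lepageQ F) (lepageR F) k' l' σ k'' l'' ν) = 0 := by
  unfold vertTable
  split <;> simp [h.vert_three_lepageP, h.vert_three_lepageQ, h.vert_three_lepageR]

namespace TrivialRelations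

variable {η : JetCoords m 3 → JetCoords m 3 [⋀^Fin 2]→L[ℝ] ℝ} {z : JetCoords m 3}

/-- No frame value of the 2-form depends on third-order coordinates, and the brackets of third-order
vectors with E_i are of order two and annihilate the form. -/
theorem extDeriv_vert_three_left (h : TrivialRelations F)
    (hη : FormTable η F (lepageP F) (lepageQ F) (lepageR F)) (hz : z ∈ jetDomain T 3)
    (l : ℕ) (ρ : Fin m) (v w : JetCoords m 3) :
    extDeriv η z ![coordVec 3 l ρ, v, w] = 0 := by
  refine form_three_contraction_eq_zero z _ _ ?_ (fun i k l' σ => ?_)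
    (fun k l' σ k' l'' ν => ?_) v w
  · obtain ⟨l₀, hl₀⟩ := shift_coordVec_three 0 l ρ
    obtain ⟨l₁, hl₁⟩ := shift_coordVec_three 1 l ρ
    rw [form_three_swap, form_three_swap_right, hη.extDeriv_base hz, hl₀, hl₁, h.three,
      form_two_swap, hη.vert_two_left hz, form_two_swap _ _ (coordVec 2 l₁ ρ),
      hη.vert_two_left hz]
    simp [baseTable]
  · obtain ⟨l₀, hl₀⟩ := shift_coordVec_three i l ρ
    rw [form_three_swap, hη.extDeriv_mixed hz, hl₀, hη.vert_two_left hz,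
      form_two_swap _ _ (coordVec 3 l ρ), hη.vert_three_left hz, h.vert_three_baseTable]
    simp [vertTable, baseTable]
  · rw [hη.extDeriv_vert hz, h.vert_three_vertTable]
    simp [vertTable]

/-- Order zero is the Euler–Lagrange equation, order one the definition of the momenta; at order two
the bracket terms cancel ∂L/∂y_ij. -/
theorem extDeriv_cutVec_cutVec (h : TrivialRelations F)
    (hη : FormTable η F (lepageP F) (lepageQ F) (lepageR F)) (hz : z ∈ jetDomain T 3)
    (w : JetCoords m 3) :
    extDeriv η z ![cutVec 0 z, cutVec 1 z, w] = 0 := by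
  refine form_three_eq_zero_of_frame z _ _ _ (fun i => ?_) (fun k l σ => ?_) w
  · have hi : i = 0 ∨ i = 1 := by omega
    rcases hi with rfl | rfl
    · rw [form_three_swap_right, form_three_self_left, neg_zero]
    · exact form_three_self_right ..
  · have h0 (v : JetCoords m 3) : η z ![v, 0] = 0 := (η z).map_coord_zero 1 rfl
    refine coordVec_cases (p := fun u => extDeriv η z ![cutVec 0 z, cutVec 1 z, u] = 0) σ
      ?_ ?_ ?_ ?_ ?_ ?_ (fun l => ?_) k l
    · rw [hη.extDeriv_base hz, shift_coordVec_zero, shift_coordVec_zero, h0, h0, h.euler]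
      simp [baseTable]
    · rw [hη.extDeriv_base hz, shift_zero_coordVec (by omega), shift_one_coordVec_zero, h0,
        hη.mixed z hz]
      simp [baseTable, momentum_zero]
      ring
    · rw [hη.extDeriv_base hz, shift_zero_coordVec (by omega), shift_one_coordVec (by omega),
        coordVec_eq_zero (k := 0) (Or.inr (by omega)), h0, hη.mixed z hz]
      simp [baseTable, momentum_one]
      ring
    · rw [hη.extDeriv_base hz, shift_zero_coordVec (by omega), shift_one_coordVec_zero, h0,
        hη.mixed z hz]
      simp [baseTable]
    · rw [hη.extDeriv_base hz, shift_zero_coordVec (by omega), shift_one_coordVec (by omega),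
        hη.mixed z hz, hη.mixed z hz]
      simp [baseTable]
      ring
    · rw [hη.extDeriv_base hz, shift_zero_coordVec (by omega), shift_one_coordVec (by omega),
        coordVec_eq_zero (k := 1) (Or.inr (by omega)), h0, hη.mixed z hz]
      simp [baseTable]
    · rw [form_three_swap_right, form_three_swap, h.extDeriv_vert_three_left hη hz]
      simp

/-- Against ∂/∂y this is the equation prescribing Q^1; against ∂/∂y_1 and ∂/∂y_2 it is the order
condition, with R^{1,2} balancing the second derivative in y_11, y_22. -/
theorem extDeriv_cutVec_zero_two_zero (h : TrivialRelations F)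
    (hη : FormTable η F (lepageP F) (lepageQ F) (lepageR F)) (hz : z ∈ jetDomain T 3)
    (σ : Fin m) (v : JetCoords m 3) :
    extDeriv η z ![cutVec 0 z, coordVec 2 0 σ, v] = 0 := by
  refine form_three_eq_zero_of_frame z _ _ _ (fun i => ?_) (fun k l ν => ?_) v
  · have hi : i = 0 ∨ i = 1 := by omega
    rcases hi with rfl | rfl
    · rw [form_three_swap_right, form_three_self_left, neg_zero]
    · rw [form_three_swap_right, h.extDeriv_cutVec_cutVec hη hz, neg_zero]
  · have h0 (v : JetCoords m 3) : η z ![0, v] = 0 := (η z).map_coord_zero 0 rfl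
    refine coordVec_cases (p := fun u => extDeriv η z ![cutVec 0 z, coordVec 2 0 σ, u] = 0) ν
      ?_ ?_ ?_ ?_ ?_ ?_ (fun l => ?_) k l
    · have h1 := congrArg (fun f => f.1 z) (h.vert_two_zero_momentum_add_lepageQ σ ν)
      rw [hη.extDeriv_mixed hz, shift_coordVec_zero, h0, shift_zero_coordVec (by omega),
        hη.vert z hz]
      simp [baseTable, vertTable] at h1 ⊢
      linarith
    · rw [hη.extDeriv_mixed hz, shift_zero_coordVec (by omega), shift_zero_coordVec (by omega),
        hη.vert z hz, hη.vert z hz]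
      simp [baseTable, vertTable, lepageR, h.d00_01]
    · rw [hη.extDeriv_mixed hz, shift_zero_coordVec (by omega), shift_zero_coordVec (by omega),
        hη.vert z hz, hη.vert z hz]
      simp [baseTable, vertTable, lepageR, h.d00_11]
    all_goals
      rw [hη.extDeriv_mixed hz, shift_zero_coordVec (by omega), shift_zero_coordVec (by omega),
        hη.vert z hz, hη.vert z hz]
      simp [baseTable, vertTable]

theorem extDeriv_cutVec_zero_two_one (h : TrivialRelations F)
    (hη : FormTable η F (lepageP F) (lepageQ F) (lepageR F)) (hz : z ∈ jetDomain T 3)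
    (σ : Fin m) (v : JetCoords m 3) :
    extDeriv η z ![cutVec 0 z, coordVec 2 1 σ, v] = 0 := by
  refine form_three_eq_zero_of_frame z _ _ _ (fun i => ?_) (fun k l ν => ?_) v
  · have hi : i = 0 ∨ i = 1 := by omega
    rcases hi with rfl | rfl
    · rw [form_three_swap_right, form_three_self_left, neg_zero]
    · rw [form_three_swap_right, h.extDeriv_cutVec_cutVec hη hz, neg_zero]
  · have h0 (v : JetCoords m 3) : η z ![0, v] = 0 := (η z).map_coord_zero 0 rfl
    refine coordVec_cases (p := fun u => extDeriv η z ![cutVec 0 z, coordVec 2 1 σ, u] = 0) ν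
      ?_ ?_ ?_ ?_ ?_ ?_ (fun l => ?_) k l
    · have h1 := congrArg (fun f => f.1 z) (h.vert_two_one_momentum_add_lepageQ σ ν)
      rw [hη.extDeriv_mixed hz, shift_coordVec_zero, h0, shift_zero_coordVec (by omega),
        hη.vert z hz]
      simp [baseTable, vertTable] at h1 ⊢
      linarith
    · rw [hη.extDeriv_mixed hz, shift_zero_coordVec (by omega), shift_zero_coordVec (by omega),
        hη.vert z hz, hη.vert z hz]
      simp [baseTable, vertTable, lepageR]
    · rw [hη.extDeriv_mixed hz, shift_zero_coordVec (by omega), shift_zero_coordVec (by omega),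
        hη.vert z hz, hη.vert z hz]
      simp [baseTable, vertTable, lepageR, h.d01_11]
    all_goals
      rw [hη.extDeriv_mixed hz, shift_zero_coordVec (by omega), shift_zero_coordVec (by omega),
        hη.vert z hz, hη.vert z hz]
      simp [baseTable, vertTable]

theorem extDeriv_cutVec_zero_one_zero_one_zero (h : TrivialRelations F)
    (hη : FormTable η F (lepageP F) (lepageQ F) (lepageR F)) (hz : z ∈ jetDomain T 3)
    (σ ν : Fin m) :
    extDeriv η z ![cutVec 0 z, coordVec 1 0 σ, coordVec 1 0 ν] = 0 := by
  have h1 := congrArg (fun f => f.1 z) (h.lepageQ_zero_skew σ ν)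
  rw [hη.extDeriv_mixed hz, shift_zero_coordVec (by omega), shift_zero_coordVec (by omega),
    hη.vert z hz, hη.vert z hz]
  simp [baseTable, vertTable, lepageR] at h1 ⊢
  linarith

/-- Only the part skew in σ, ν is shown to vanish here. The symmetric part is removed by d∘d = 0 in
`extDeriv_cutVec_zero`. -/
theorem extDeriv_cutVec_zero_one_zero_symm (h : TrivialRelations F)
    (hη : FormTable η F (lepageP F) (lepageQ F) (lepageR F)) (hz : z ∈ jetDomain T 3)
    (σ ν : Fin m) :
    extDeriv η z ![cutVec 0 z, coordVec 1 0 σ, coordVec 0 0 ν] =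
      extDeriv η z ![cutVec 0 z, coordVec 1 0 ν, coordVec 0 0 σ] := by
  have h0 (v : JetCoords m 3) : η z ![0, v] = 0 := (η z).map_coord_zero 0 rfl
  have h1 := congrArg (fun f => f.1 z) (h.lepageP_eq σ ν)
  rw [hη.extDeriv_mixed hz, hη.extDeriv_mixed hz, shift_zero_coordVec (by omega),
    shift_zero_coordVec (by omega), shift_coordVec_zero, shift_coordVec_zero, h0, h0,
    hη.vert z hz, hη.vert z hz]
  simp [baseTable, vertTable] at h1 ⊢
  linarith

end TrivialRelations

/-- The relation between the two contractions of the exterior derivative, for vertical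
arguments. -/
theorem TrivialRelations.contraction_relation (h : TrivialRelations F)
    {η : JetCoords m 3 → JetCoords m 3 [⋀^Fin 2]→L[ℝ] ℝ}
    (hη : FormTable η F (lepageP F) (lepageQ F) (lepageR F)) {u v : JetCoords m 3}
    (h₀ : ∀ z ∈ jetDomain T 3, extDeriv η z ![cutVec 0 z, u, v] = 0)
    (h₁ : ∀ z ∈ jetDomain T 3, extDeriv η z ![cutVec 1 z, u, v] = 0)
    {z : JetCoords m 3} (hz : z ∈ jetDomain T 3) :
    extDeriv η z ![cutVec 1 z, shift 0 u, v] + extDeriv η z ![cutVec 1 z, u, shift 0 v] =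
      extDeriv η z ![cutVec 0 z, shift 1 u, v] + extDeriv η z ![cutVec 0 z, u, shift 1 v] := by
  have key := form_three_contraction_relation (D := jetDomain T 3) (η := extDeriv η)
    (e := vecX 0) (e' := vecX 1) (u := u) (v := v) (N := shift 0) (N' := shift 1) (z := z)
    ((hη.contDiffAt_extDeriv hz).differentiableAt (by simp)) (hη.extDeriv_extDeriv_eq_zero hz) hz
    (by simp [affineField, shift_vecX, shift_shift 1 0])
  simp only [← cutVec_eq_affineField] at key
  exact key (fun z hz w => h.extDeriv_cutVec_cutVec hη hz w) h₀ h₁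

/-- The contraction of the exterior derivative with `cutVec 0` vanishes. -/
theorem TrivialRelations.extDeriv_cutVec_zero (h : TrivialRelations F)
    {η : JetCoords m 3 → JetCoords m 3 [⋀^Fin 2]→L[ℝ] ℝ}
    (hη : FormTable η F (lepageP F) (lepageQ F) (lepageR F)) {z : JetCoords m 3}
    (hz : z ∈ jetDomain T 3) (v w : JetCoords m 3) : extDeriv η z ![cutVec 0 z, v, w] = 0 := by
  have map_zero_mid (z) (a b : JetCoords m 3) : extDeriv η z ![a, 0, b] = 0 :=
    (extDeriv η z).map_coord_zero 1 rfl
  have map_zero_right (z) (a b : JetCoords m 3) : extDeriv η z ![a, b, 0] = 0 :=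
    (extDeriv η z).map_coord_zero 2 rfl
  have rel := fun {u v : JetCoords m 3} => h.contraction_relation hη (u := u) (v := v)
  have three (l σ) : ∀ z ∈ jetDomain T 3, ∀ i v,
      extDeriv η z ![cutVec i z, coordVec 3 l σ, v] = 0 := fun z hz i v => by
    rw [form_three_swap, h.extDeriv_vert_three_left hη hz, neg_zero]
  -- Apply the relation to a third-order vector u: the terms still containing u vanish, leaving
  -- those with its brackets.
  have rel3 (l σ) : ∀ z ∈ jetDomain T 3, ∀ v,
      extDeriv η z ![cutVec 1 z, coordVec 2 l σ, v] =
        extDeriv η z ![cutVec 0 z, shift 1 (coordVec 3 l σ), v] := fun z hz v => by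
    have := rel (fun z hz => three l σ z hz 0 v) (fun z hz => three l σ z hz 1 v) hz
    rw [shift_zero_coordVec (by omega), three l σ z hz, three l σ z hz] at this
    simpa using this
  have two₀ (l σ) : ∀ z ∈ jetDomain T 3, ∀ v,
      extDeriv η z ![cutVec 0 z, coordVec 2 l σ, v] = 0 := fun z hz v => by
    match l with
    | 0 => exact h.extDeriv_cutVec_zero_two_zero hη hz σ v
    | 1 => exact h.extDeriv_cutVec_zero_two_one hη hz σ v
    | 2 =>
      -- For ∂/∂y_222, removing an index 1 gives zero and removing a 2 gives ∂/∂y_22. Hence this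
      -- case needs no direct computation.
      have := rel3 3 σ z hz v
      rw [shift_one_coordVec (by omega), coordVec_eq_zero (Or.inr (by omega)),
        map_zero_mid] at this
      exact this.symm
    | l + 3 => rw [coordVec_eq_zero (Or.inr (by omega)), map_zero_mid]
  have two₁ (l σ) : ∀ z ∈ jetDomain T 3, ∀ v,
      extDeriv η z ![cutVec 1 z, coordVec 2 l σ, v] = 0 := fun z hz v => by
    obtain ⟨l', hl'⟩ := shift_coordVec_three 1 l σ
    rw [rel3 l σ z hz, hl', two₀ l' σ z hz]
  have rel2 (l σ) : ∀ z ∈ jetDomain T 3, ∀ v,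
      extDeriv η z ![cutVec 1 z, coordVec 1 l σ, v] =
        extDeriv η z ![cutVec 0 z, shift 1 (coordVec 2 l σ), v] := fun z hz v => by
    have := rel (fun z hz => two₀ l σ z hz v) (fun z hz => two₁ l σ z hz v) hz
    rw [shift_zero_coordVec (by omega), two₀ l σ z hz, two₁ l σ z hz] at this
    simpa using this
  have oneOne₀ (σ) : ∀ z ∈ jetDomain T 3, ∀ v,
      extDeriv η z ![cutVec 0 z, coordVec 1 1 σ, v] = 0 := fun z hz v => by
    have := rel2 2 σ z hz v
    rw [shift_one_coordVec (by omega), coordVec_eq_zero (Or.inr (by omega)), map_zero_mid] at this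
    exact this.symm
  have oneOne₁ (σ) : ∀ z ∈ jetDomain T 3, ∀ v,
      extDeriv η z ![cutVec 1 z, coordVec 1 1 σ, v] =
        extDeriv η z ![cutVec 0 z, coordVec 1 0 σ, v] := fun z hz v => by
    rw [rel2 1 σ z hz, shift_one_coordVec (by omega)]
  -- The relation for u = ∂/∂y^σ_2, v = ∂/∂y^ν_1 makes this component skew in σ, ν; by direct
  -- computation it is symmetric, so it vanishes.
  have skew (σ ν) : ∀ z ∈ jetDomain T 3,
      extDeriv η z ![cutVec 0 z, coordVec 1 0 σ, coordVec 0 0 ν] = 0 := fun z hz => by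
    have h1 := rel (u := coordVec 1 1 σ) (v := coordVec 1 0 ν)
      (fun z hz => oneOne₀ σ z hz _)
      (fun z hz => (oneOne₁ σ z hz _).trans
        (h.extDeriv_cutVec_zero_one_zero_one_zero hη hz σ ν)) hz
    rw [shift_zero_coordVec (by omega), coordVec_eq_zero (k := 0) (Or.inr (by omega)),
      map_zero_mid, shift_zero_coordVec (by omega), oneOne₁ σ z hz, shift_one_coordVec (by omega),
      shift_one_coordVec_zero, map_zero_right, form_three_swap_right _ _ (coordVec 0 0 σ)] at h1
    have h2 := h.extDeriv_cutVec_zero_one_zero_symm hη hz σ ν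
    linarith
  have oneZero (σ) : ∀ z ∈ jetDomain T 3, ∀ v,
      extDeriv η z ![cutVec 0 z, coordVec 1 0 σ, v] = 0 := fun z hz v => by
    refine form_three_eq_zero_of_frame z _ _ _ (fun i => ?_) (fun k l ν => ?_) v
    · have hi : i = 0 ∨ i = 1 := by omega
      rcases hi with rfl | rfl
      · rw [form_three_swap_right, form_three_self_left, neg_zero]
      · rw [form_three_swap_right, h.extDeriv_cutVec_cutVec hη hz, neg_zero]
    · refine coordVec_cases
        (p := fun u => extDeriv η z ![cutVec 0 z, coordVec 1 0 σ, u] = 0) ν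
        (skew σ ν z hz) (h.extDeriv_cutVec_zero_one_zero_one_zero hη hz σ ν) ?_ ?_ ?_ ?_
        (fun l => ?_) k l
      · rw [form_three_swap_right, oneOne₀ ν z hz, neg_zero]
      · rw [form_three_swap_right, two₀ 0 ν z hz, neg_zero]
      · rw [form_three_swap_right, two₀ 1 ν z hz, neg_zero]
      · rw [form_three_swap_right, two₀ 2 ν z hz, neg_zero]
      · rw [form_three_swap_right, three l ν z hz, neg_zero]
  -- Take u = ∂/∂y_2: its bracket with E_0 is zero, and its bracket with E_1 is ∂/∂y.
  have zero (σ) : ∀ z ∈ jetDomain T 3, ∀ v,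
      extDeriv η z ![cutVec 0 z, coordVec 0 0 σ, v] = 0 := fun z hz v => by
    have h1 (v) : ∀ z ∈ jetDomain T 3, extDeriv η z ![cutVec 1 z, coordVec 1 1 σ, v] = 0 :=
      fun z hz => (oneOne₁ σ z hz v).trans (oneZero σ z hz v)
    have h2 := rel (fun z hz => oneOne₀ σ z hz v) (h1 v) hz
    rw [shift_zero_coordVec (by omega), coordVec_eq_zero (Or.inr (by omega)), map_zero_mid,
      h1 _ z hz, shift_one_coordVec (by omega), oneOne₀ σ z hz] at h2
    linarith
  refine form_three_contraction_eq_zero z _ _ (form_three_self_left ..) (fun i k l σ => ?_)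
    (fun k l σ k' l' ν => ?_) v w
  · have hi : i = 0 ∨ i = 1 := by omega
    rcases hi with rfl | rfl
    · exact form_three_self_left ..
    · exact h.extDeriv_cutVec_cutVec hη hz _
  · exact coordVec_cases
      (p := fun u => extDeriv η z ![cutVec 0 z, u, coordVec k' l' ν] = 0) σ
      (zero σ z hz _) (oneZero σ z hz _) (oneOne₀ σ z hz _) (two₀ 0 σ z hz _) (two₀ 1 σ z hz _)
      (two₀ 2 σ z hz _) (fun l => three l σ z hz 0 _) k l

/-- A form with the coefficients of the fundamental form is closed if the Lagrangian is
trivial. -/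
theorem TrivialRelations.extDeriv_eq_zero (h : TrivialRelations F)
    {η : JetCoords m 3 → JetCoords m 3 [⋀^Fin 2]→L[ℝ] ℝ}
    (hη : FormTable η F (lepageP F) (lepageQ F) (lepageR F)) {z : JetCoords m 3}
    (hz : z ∈ jetDomain T 3) : extDeriv η z = 0 := by
  -- Brackets with E_0 alone suffice: every `coordVec k l σ` with `k < 3` is `shift 0` of `coordVec
  -- (k + 1) l σ`.
  have down {u : JetCoords m 3}
      (hu : ∀ z ∈ jetDomain T 3, ∀ v w, extDeriv η z ![u, v, w] = 0) :
      ∀ z ∈ jetDomain T 3, ∀ v w, extDeriv η z ![shift 0 u, v, w] = 0 := fun z hz v w =>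
    form_three_bracket_eq_zero (e := vecX 0) (η := extDeriv η)
      (fun z hz => (hη.contDiffAt_extDeriv hz).differentiableAt (by simp))
      (fun z hz => hη.extDeriv_extDeriv_eq_zero hz)
      (fun z hz v w => by
        rw [← cutVec_eq_affineField]
        exact h.extDeriv_cutVec_zero hη hz v w) hu hz v w
  have three (l σ) : ∀ z ∈ jetDomain T 3, ∀ v w, extDeriv η z ![coordVec 3 l σ, v, w] = 0 :=
    fun z hz v w => h.extDeriv_vert_three_left hη hz l σ v w
  have two (l σ) : ∀ z ∈ jetDomain T 3, ∀ v w, extDeriv η z ![coordVec 2 l σ, v, w] = 0 := by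
    rw [← shift_zero_coordVec (by omega)]
    exact down (three l σ)
  have one (l σ) : ∀ z ∈ jetDomain T 3, ∀ v w, extDeriv η z ![coordVec 1 l σ, v, w] = 0 := by
    rw [← shift_zero_coordVec (by omega)]
    exact down (two l σ)
  have zero (l σ) : ∀ z ∈ jetDomain T 3, ∀ v w, extDeriv η z ![coordVec 0 l σ, v, w] = 0 := by
    rw [← shift_zero_coordVec (by omega)]
    exact down (one l σ)
  have vert (k l σ v w) : extDeriv η z ![coordVec k l σ, v, w] = 0 :=
    coordVec_cases (p := fun u => extDeriv η z ![u, v, w] = 0) σ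
      (zero 0 σ z hz _ _) (one 0 σ z hz _ _) (one 1 σ z hz _ _) (two 0 σ z hz _ _)
      (two 1 σ z hz _ _) (two 2 σ z hz _ _) (fun l => three l σ z hz _ _) k l
  have e₀ := h.extDeriv_cutVec_zero hη hz
  have e₁ (v w) : extDeriv η z ![cutVec 1 z, v, w] = 0 := by
    refine form_three_contraction_eq_zero z _ _ ?_ (fun i k l σ => ?_)
      (fun k l σ k' l' ν => ?_) v w
    · exact (form_three_swap _ _ _ _).trans (by rw [e₀, neg_zero])
    · rw [form_three_swap_right, form_three_swap, vert, neg_zero, neg_zero]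
    · rw [form_three_swap, vert, neg_zero]
  refine ContinuousAlternatingMap.ext fun v => ?_
  have hv : v = ![v 0, v 1, v 2] := by
    funext i
    fin_cases i <;> rfl
  rw [hv]
  refine form_three_eq_zero_of_frame z _ _ _ (fun i => ?_) (fun k l σ => ?_) _
  · have hi : i = 0 ∨ i = 1 := by omega
    rw [form_three_swap_right, form_three_swap]
    rcases hi with rfl | rfl
    · rw [e₀, neg_zero, neg_zero]
    · rw [e₁, neg_zero, neg_zero]
  · rw [form_three_swap_right, form_three_swap, vert, neg_zero, neg_zero]

/-! ### The descent argument behind uniqueness. -/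

/-- A closed 2-form annihilated by `cutVec 0` and by the vertical coordinate vectors of third order
is annihilated by all vertical coordinate vectors. -/
theorem form_two_vert_eq_zero_of_closed {η : JetCoords m 3 → JetCoords m 3 [⋀^Fin 2]→L[ℝ] ℝ}
    (hη : ∀ z ∈ jetDomain T 3, DifferentiableAt ℝ η z)
    (hd : ∀ z ∈ jetDomain T 3, extDeriv η z = 0)
    (hE : ∀ z ∈ jetDomain T 3, ∀ v, η z ![cutVec 0 z, v] = 0)
    (h3 : ∀ z ∈ jetDomain T 3, ∀ l σ v, η z ![coordVec 3 l σ, v] = 0)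
    {z : JetCoords m 3} (hz : z ∈ jetDomain T 3) (k l : ℕ) (σ : Fin m) (v : JetCoords m 3) :
    η z ![coordVec k l σ, v] = 0 := by
  have down {u : JetCoords m 3} (hu : ∀ z ∈ jetDomain T 3, ∀ v, η z ![u, v] = 0) :
      ∀ z ∈ jetDomain T 3, ∀ v, η z ![shift 0 u, v] = 0 := fun z hz v =>
    form_two_bracket_eq_zero (e := vecX 0) hη hd
      (fun z hz v => by rw [← cutVec_eq_affineField]; exact hE z hz v) hu hz v
  have two (l σ) : ∀ z ∈ jetDomain T 3, ∀ v, η z ![coordVec 2 l σ, v] = 0 := by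
    rw [← shift_zero_coordVec (by omega)]
    exact down fun z hz => h3 z hz l σ
  have one (l σ) : ∀ z ∈ jetDomain T 3, ∀ v, η z ![coordVec 1 l σ, v] = 0 := by
    rw [← shift_zero_coordVec (by omega)]
    exact down (two l σ)
  have zero (l σ) : ∀ z ∈ jetDomain T 3, ∀ v, η z ![coordVec 0 l σ, v] = 0 := by
    rw [← shift_zero_coordVec (by omega)]
    exact down (one l σ)
  exact coordVec_cases (p := fun u => η z ![u, v] = 0) σ
    (zero 0 σ z hz _) (one 0 σ z hz _) (one 1 σ z hz _) (two 0 σ z hz _)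
    (two 1 σ z hz _) (two 2 σ z hz _) (fun l => h3 z hz l σ _) k l

end Closedness

/-! ### The ansatz in the adapted frame -/

section Ansatz

open TopologicalSpace (Opens)

variable {m : ℕ} {T : Opens ((Fin 2 → ℝ) × (Fin m → ℝ))}

theorem dx_coordVec {r : ℕ} (i : Fin 2) (k l : ℕ) (ν : Fin m) :
    (dx i : JetCoords m r →L[ℝ] ℝ) (coordVec k l ν) = 0 := rfl

theorem dx_cutVec {r : ℕ} (i j : Fin 2) (z : JetCoords m r) :
    (dx i : JetCoords m r →L[ℝ] ℝ) (cutVec j z) = if i = j then 1 else 0 := by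
  simp [dx, cutVec, Pi.single_apply]

theorem omegaBase_coordVec {r : ℕ} (i : Fin 2) (k l : ℕ) (ν : Fin m) :
    (omegaBase i : JetCoords m r →L[ℝ] ℝ) (coordVec k l ν) = 0 := by
  unfold omegaBase
  split_ifs <;> simp [dx_coordVec]

theorem contact_cutVec {r : ℕ} (k l : ℕ) (hk : k < r) (hl : l < k + 1) (σ : Fin m)
    (z : JetCoords m r) (i : Fin 2) : contact k l hk hl σ z (cutVec i z) = 0 := by
  have h1 : (dyForm k l (by omega) hl σ : JetCoords m r →L[ℝ] ℝ) (cutVec i z) =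
      z.2 ⟨k + 1, by omega⟩ ⟨l + (i : ℕ), by simp only; omega⟩ σ := by
    simp [dyForm, cutVec, hk]
  rw [contact, sub_apply, h1]
  have hi : i = 0 ∨ i = 1 := by omega
  rcases hi with rfl | rfl <;> simp [dx_cutVec]

theorem contact_coordVec {r : ℕ} (k l : ℕ) (hk : k < r) (hl : l < k + 1) (σ : Fin m)
    (z : JetCoords m r) (k' l' : ℕ) (ν : Fin m) :
    contact k l hk hl σ z (coordVec k' l' ν) = if k = k' ∧ l = l' ∧ σ = ν then 1 else 0 := by
  have h1 : (dyForm k l (by omega) hl σ : JetCoords m r →L[ℝ] ℝ) (coordVec k' l' ν) =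
      if k = k' ∧ l = l' ∧ σ = ν then 1 else 0 := rfl
  simp [contact, h1, dx_coordVec]

theorem om_cutVec (σ : Fin m) (z : JetCoords m 3) (i : Fin 2) : om σ z (cutVec i z) = 0 :=
  contact_cutVec ..

theorem om1_cutVec (j : Fin 2) (σ : Fin m) (z : JetCoords m 3) (i : Fin 2) :
    om1 j σ z (cutVec i z) = 0 :=
  contact_cutVec ..

theorem om_coordVec (σ : Fin m) (z : JetCoords m 3) (k l : ℕ) (ν : Fin m) :
    om σ z (coordVec k l ν) = if 0 = k ∧ 0 = l ∧ σ = ν then 1 else 0 :=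
  contact_coordVec ..

theorem om1_coordVec (j : Fin 2) (σ : Fin m) (z : JetCoords m 3) (k l : ℕ) (ν : Fin m) :
    om1 j σ z (coordVec k l ν) = if 1 = k ∧ (j : ℕ) = l ∧ σ = ν then 1 else 0 :=
  contact_coordVec ..

/-- The coefficient of `ω^σ ∧ ω_j` in the generalized Poincaré–Cartan form. -/
theorem momentum_apply {F : smoothFn (jetDomain T 3)} {L : JetCoords m 2 → ℝ}
    (hF : IsPullback F L) (j : Fin 2) (σ : Fin m) {z : JetCoords m 3} (hz : z ∈ jetDomain T 3) :
    dY1 j σ L (proj z) - ∑ i : Fin 2, formalD i (dY2 i j σ L) z = (momentum F j σ).1 z := by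
  rw [← (hF.dY1 j σ).2 z hz]
  simp only [Fin.sum_univ_two, ← (hF.dY2 _ j σ).cut_apply _ hz]
  have hj : j = 0 ∨ j = 1 := by omega
  rcases hj with rfl | rfl
  · simp [momentum_zero]
    ring
  · simp [momentum_one]
    ring

theorem ansatz_base (L : JetCoords m 2 → ℝ) (K : Coeffs m) (z : JetCoords m 3) :
    ansatz L K z ![cutVec 0 z, cutVec 1 z] = L (proj z) := by
  simp [ansatz, poincareCartan, wedge_apply, om_cutVec, om1_cutVec, dx_cutVec]

/-- Contact forms vanish on `cutVec i`, so P, Q and R drop out. Uniqueness rests on this. -/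
theorem ansatz_mixed (L : JetCoords m 2 → ℝ) (K : Coeffs m) (z : JetCoords m 3) (i : Fin 2)
    (k l : ℕ) (σ : Fin m) :
    ansatz L K z ![cutVec i z, coordVec k l σ] =
      -(∑ τ, ∑ j, (dY1 j τ L (proj z) - ∑ i : Fin 2, formalD i (dY2 i j τ L) z) *
          ((if 0 = k ∧ 0 = l ∧ τ = σ then 1 else 0) * omegaBase j (cutVec i z)))
        - ∑ τ, ∑ i', ∑ j, dY2 i' j τ L (proj z) *
          ((if 1 = k ∧ (i' : ℕ) = l ∧ τ = σ then 1 else 0) * omegaBase j (cutVec i z)) := by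
  simp only [ansatz, poincareCartan, wedge_apply, om_cutVec, om1_cutVec, dx_coordVec,
    omegaBase_coordVec, om_coordVec, om1_coordVec, ContinuousAlternatingMap.add_apply,
    ContinuousAlternatingMap.smul_apply, ContinuousAlternatingMap.sum_apply, smul_eq_mul,
    Matrix.cons_val_zero, Matrix.cons_val_one, mul_zero, zero_mul, sub_zero, zero_sub,
    Finset.sum_const_zero, add_zero, zero_add, mul_neg, Finset.sum_neg_distrib]
  ring

theorem ansatz_vert (L : JetCoords m 2 → ℝ) (K : Coeffs m) (z : JetCoords m 3)
    (k l : ℕ) (σ : Fin m) (k' l' : ℕ) (ν : Fin m) :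
    ansatz L K z ![coordVec k l σ, coordVec k' l' ν] =
      ∑ α, ∑ β, (1 / 2 : ℝ) * K.P α β z *
          ((if 0 = k ∧ 0 = l ∧ α = σ then 1 else 0) * (if 0 = k' ∧ 0 = l' ∧ β = ν then 1 else 0)
          - (if 0 = k' ∧ 0 = l' ∧ α = ν then 1 else 0) * (if 0 = k ∧ 0 = l ∧ β = σ then 1 else 0))
        + ∑ j : Fin 2, ∑ α, ∑ β, K.Q j α β z *
          ((if 0 = k ∧ 0 = l ∧ α = σ then 1 else 0)
              * (if 1 = k' ∧ (j : ℕ) = l' ∧ β = ν then 1 else 0)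
          - (if 0 = k' ∧ 0 = l' ∧ α = ν then 1 else 0)
              * (if 1 = k ∧ (j : ℕ) = l ∧ β = σ then 1 else 0))
        + ∑ i : Fin 2, ∑ j : Fin 2, ∑ α, ∑ β, (1 / 2 : ℝ) * K.R i j α β z *
          ((if 1 = k ∧ (i : ℕ) = l ∧ α = σ then 1 else 0)
              * (if 1 = k' ∧ (j : ℕ) = l' ∧ β = ν then 1 else 0)
          - (if 1 = k' ∧ (i : ℕ) = l' ∧ α = ν then 1 else 0)
              * (if 1 = k ∧ (j : ℕ) = l ∧ β = σ then 1 else 0)) := by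
  simp only [ansatz, poincareCartan, wedge_apply, dx_coordVec,
    omegaBase_coordVec, om_coordVec, om1_coordVec, ContinuousAlternatingMap.add_apply,
    ContinuousAlternatingMap.smul_apply, ContinuousAlternatingMap.sum_apply, smul_eq_mul,
    Matrix.cons_val_zero, Matrix.cons_val_one, mul_zero, sub_zero,
    Finset.sum_const_zero, zero_add]

theorem omegaBase_cutVec {r : ℕ} (i j : Fin 2) (z : JetCoords m r) :
    (omegaBase j : JetCoords m r →L[ℝ] ℝ) (cutVec i z) =
      if j = 0 then (if i = 1 then 1 else 0) else (if i = 0 then -1 else 0) := by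
  unfold omegaBase
  have hi : i = 0 ∨ i = 1 := by omega
  split_ifs <;> rcases hi with rfl | rfl <;> simp_all [dx_cutVec]

theorem ansatz_mixed_eq_baseTable {F : smoothFn (jetDomain T 3)} {L : JetCoords m 2 → ℝ}
    (hF : IsPullback F L) (K : Coeffs m) {z : JetCoords m 3} (hz : z ∈ jetDomain T 3)
    (i : Fin 2) (k l : ℕ) (σ : Fin m) :
    ansatz L K z ![cutVec i z, coordVec k l σ] = (baseTable F i k l σ).1 z := by
  rw [ansatz_mixed]
  simp only [momentum_apply hF _ _ hz, ← (hF.dY2 _ _ _).2 z hz, omegaBase_cutVec]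
  have hi : i = 0 ∨ i = 1 := by omega
  match k, l with
  | 0, 0 => rcases hi with rfl | rfl <;> simp [baseTable]
  | 1, 0 => rcases hi with rfl | rfl <;> simp [baseTable]
  | 1, 1 => rcases hi with rfl | rfl <;> simp [baseTable]
  | 0, l + 1 => rcases hi with rfl | rfl <;> simp [baseTable]
  | 1, l + 2 => rcases hi with rfl | rfl <;> simp [baseTable]
  | k + 2, l => rcases hi with rfl | rfl <;> simp [baseTable]

theorem ansatz_vert_eq_vertTable {L : JetCoords m 2 → ℝ} {K : Coeffs m}
    {P : Fin m → Fin m → smoothFn (jetDomain T 3)}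
    {Q : Fin 2 → Fin m → Fin m → smoothFn (jetDomain T 3)}
    {R : Fin 2 → Fin 2 → Fin m → Fin m → smoothFn (jetDomain T 3)}
    {z : JetCoords m 3} (hP : ∀ σ ν, K.P σ ν z = (P σ ν).1 z)
    (hQ : ∀ j σ ν, K.Q j σ ν z = (Q j σ ν).1 z) (hR : ∀ i j σ ν, K.R i j σ ν z = (R i j σ ν).1 z)
    (skewP : ∀ σ ν, (P σ ν).1 z = -(P ν σ).1 z)
    (skewR : ∀ i j σ ν, (R i j σ ν).1 z = -(R j i ν σ).1 z)
    (k l : ℕ) (σ : Fin m) (k' l' : ℕ) (ν : Fin m) :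
    ansatz L K z ![coordVec k l σ, coordVec k' l' ν] = (vertTable P Q R k l σ k' l' ν).1 z := by
  rw [ansatz_vert]
  simp only [hP, hQ, hR, mul_sub, Finset.sum_sub_distrib]
  -- Each factor 1/2 in the P and R terms is compensated by skew-symmetry, as every entry arises
  -- twice.
  have sP := skewP ν σ
  have s00 := skewR 0 0 ν σ
  have s01 := skewR 0 1 ν σ
  have s10 := skewR 1 0 ν σ
  have s11 := skewR 1 1 ν σ
  rcases k with _ | _ | k <;> rcases l with _ | _ | l <;> rcases k' with _ | _ | k' <;>
    rcases l' with _ | _ | l' <;> simp [vertTable] <;> linarith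

theorem wedge_isBilinear (E : Type*) [NormedAddCommGroup E] [NormedSpace ℝ E] :
    IsBilinearMap ℝ (wedge : (E →L[ℝ] ℝ) → (E →L[ℝ] ℝ) → E [⋀^Fin 2]→L[ℝ] ℝ) where
  add_left a b c := by
    refine ContinuousAlternatingMap.ext fun v => ?_
    simp only [wedge_apply, add_apply, ContinuousAlternatingMap.add_apply]
    ring
  smul_left t a b := by
    refine ContinuousAlternatingMap.ext fun v => ?_
    simp only [wedge_apply, smul_apply, ContinuousAlternatingMap.smul_apply, smul_eq_mul]
    ring
  add_right a b c := by
    refine ContinuousAlternatingMap.ext fun v => ?_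
    simp only [wedge_apply, add_apply, ContinuousAlternatingMap.add_apply]
    ring
  smul_right t a b := by
    refine ContinuousAlternatingMap.ext fun v => ?_
    simp only [wedge_apply, smul_apply, ContinuousAlternatingMap.smul_apply, smul_eq_mul]
    ring

/-- In finite dimension a bilinear map is continuous, hence smooth. -/
theorem contDiff_wedge {E : Type*} [NormedAddCommGroup E] [NormedSpace ℝ E]
    [FiniteDimensional ℝ E] {α β : E → E →L[ℝ] ℝ} (hα : ContDiff ℝ ∞ α) (hβ : ContDiff ℝ ∞ β) :
    ContDiff ℝ ∞ fun z => wedge (α z) (β z) := by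
  have h := ((wedge_isBilinear E).toContinuousBilinearMap.contDiff.comp hα).clm_apply hβ
  exact h

theorem contDiff_contact {r : ℕ} (k l : ℕ) (hk : k < r) (hl : l < k + 1) (σ : Fin m) :
    ContDiff ℝ ∞ fun z : JetCoords m r => contact k l hk hl σ z := by
  exact contDiff_const.sub (ContDiff.sum fun i _ =>
    (dyForm (k + 1) (l + (i : ℕ)) (by omega) (by omega) σ).contDiff.smul contDiff_const)

theorem contDiff_om (σ : Fin m) : ContDiff ℝ ∞ (om σ) := contDiff_contact ..

theorem contDiff_om1 (j : Fin 2) (σ : Fin m) : ContDiff ℝ ∞ (om1 j σ) := contDiff_contact ..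

theorem contDiffOn_ansatz {F : smoothFn (jetDomain T 3)} {L : JetCoords m 2 → ℝ}
    (hF : IsPullback F L) {K : Coeffs m} (hK : K.Admissible (jetDomain T 3)) :
    ContDiffOn ℝ ∞ (ansatz L K) (jetDomain T 3) := by
  have hw {α β : JetCoords m 3 → JetCoords m 3 →L[ℝ] ℝ} {f : JetCoords m 3 → ℝ}
      (hα : ContDiff ℝ ∞ α) (hβ : ContDiff ℝ ∞ β) (hf : ContDiffOn ℝ ∞ f (jetDomain T 3)) :
      ContDiffOn ℝ ∞ (fun z => f z • wedge (α z) (β z)) (jetDomain T 3) :=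
    hf.smul (contDiff_wedge hα hβ).contDiffOn
  have pull {a : smoothFn (jetDomain T 3)} {f : JetCoords m 2 → ℝ} (ha : IsPullback a f) :
      ContDiffOn ℝ ∞ (fun z => f (proj z)) (jetDomain T 3) :=
    a.2.1.congr fun z hz => (ha.2 z hz).symm
  refine ContDiffOn.add (ContDiffOn.add (ContDiffOn.add (ContDiffOn.add (ContDiffOn.add
    (hw contDiff_const contDiff_const (pull hF)) ?_) ?_) ?_) ?_) ?_
  · refine ContDiffOn.sum fun σ _ => ContDiffOn.sum fun j _ =>
      hw (contDiff_om σ) contDiff_const ?_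
    exact (momentum F j σ).2.1.congr fun z hz => momentum_apply hF j σ hz
  · exact ContDiffOn.sum fun σ _ => ContDiffOn.sum fun i _ => ContDiffOn.sum fun j _ =>
      hw (contDiff_om1 i σ) contDiff_const (pull (hF.dY2 i j σ))
  · exact ContDiffOn.sum fun σ _ => ContDiffOn.sum fun ν _ =>
      hw (contDiff_om σ) (contDiff_om ν) (contDiffOn_const.mul (hK.smooth_P σ ν))
  · exact ContDiffOn.sum fun j _ => ContDiffOn.sum fun σ _ => ContDiffOn.sum fun ν _ =>
      hw (contDiff_om σ) (contDiff_om1 j ν) (hK.smooth_Q j σ ν)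
  · exact ContDiffOn.sum fun i _ => ContDiffOn.sum fun j _ => ContDiffOn.sum fun σ _ =>
      ContDiffOn.sum fun ν _ =>
        hw (contDiff_om1 i σ) (contDiff_om1 j ν) (contDiffOn_const.mul (hK.smooth_R i j σ ν))

end Ansatz

/-! ### The fundamental form -/

section Fundamental

open TopologicalSpace (Opens)

variable {m : ℕ} {T : Opens ((Fin 2 → ℝ) × (Fin m → ℝ))} {F : smoothFn (jetDomain T 3)}
  {L : JetCoords m 2 → ℝ}

theorem formTable_ansatz (hF : IsPullback F L) {K : Coeffs m}
    (hK : K.Admissible (jetDomain T 3)) {P : Fin m → Fin m → smoothFn (jetDomain T 3)}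
    {Q : Fin 2 → Fin m → Fin m → smoothFn (jetDomain T 3)}
    {R : Fin 2 → Fin 2 → Fin m → Fin m → smoothFn (jetDomain T 3)}
    (hP : ∀ z ∈ jetDomain T 3, ∀ σ ν, K.P σ ν z = (P σ ν).1 z)
    (hQ : ∀ z ∈ jetDomain T 3, ∀ j σ ν, K.Q j σ ν z = (Q j σ ν).1 z)
    (hR : ∀ z ∈ jetDomain T 3, ∀ i j σ ν, K.R i j σ ν z = (R i j σ ν).1 z) :
    FormTable (ansatz L K) F P Q R where
  smooth := contDiffOn_ansatz hF hK
  base z hz := (ansatz_base L K z).trans (hF.2 z hz).symm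
  mixed z hz i k l σ := ansatz_mixed_eq_baseTable hF K hz i k l σ
  vert z hz k l σ k' l' ν := ansatz_vert_eq_vertTable (hP z hz) (hQ z hz) (hR z hz)
    (fun σ ν => by rw [← hP z hz, ← hP z hz, hK.skew_P σ ν z hz])
    (fun i j σ ν => by rw [← hR z hz, ← hR z hz, hK.skew_R i j σ ν z hz]) k l σ k' l' ν

theorem formTable_ansatz_restr (hF : IsPullback F L) {K : Coeffs m}
    (hK : K.Admissible (jetDomain T 3)) :
    FormTable (ansatz L K) F (fun σ ν => restr (K.P σ ν) (hK.smooth_P σ ν))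
      (fun j σ ν => restr (K.Q j σ ν) (hK.smooth_Q j σ ν))
      (fun i j σ ν => restr (K.R i j σ ν) (hK.smooth_R i j σ ν)) :=
  formTable_ansatz hF hK (fun _ hz _ _ => (restr_apply _ hz).symm)
    (fun _ hz _ _ _ => (restr_apply _ hz).symm) (fun _ hz _ _ _ _ => (restr_apply _ hz).symm)

theorem orderRelations_of_orderConditionAt (hF : IsPullback F L)
    (h : ∀ z ∈ jetDomain T 2, OrderConditionAt L z) : OrderRelations F := by
  have key (p q i j : Fin 2) (σ ν : Fin m) :
      (if p = q then (1 : ℝ) else 1 / 2) • dVert 2 (p + q : ℕ) ν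
          ((if i = j then (1 : ℝ) else 1 / 2) • dVert 2 (i + j : ℕ) σ F)
        + (if i = p then (1 : ℝ) else 1 / 2) • dVert 2 (i + p : ℕ) ν
          ((if q = j then (1 : ℝ) else 1 / 2) • dVert 2 (q + j : ℕ) σ F)
        + (if q = i then (1 : ℝ) else 1 / 2) • dVert 2 (q + i : ℕ) ν
          ((if p = j then (1 : ℝ) else 1 / 2) • dVert 2 (p + j : ℕ) σ F) = 0 := by
    ext z hz
    exact ((((hF.dY2 i j σ).dY2 p q ν).add ((hF.dY2 q j σ).dY2 i p ν)).add
      ((hF.dY2 p j σ).dY2 q i ν)).2 z hz |>.trans (h _ (proj_mem hz) p q i j σ ν)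
  have cancel {a : smoothFn (jetDomain T 3)} {c : ℝ} (hc : c ≠ 0) (ha : c • a = 0) : a = 0 :=
    (smul_eq_zero.1 ha).resolve_left hc
  refine ⟨hF.vert_three, fun σ ν => ?_, fun σ ν => ?_, fun σ ν => ?_, fun σ ν => ?_,
    fun σ ν => ?_⟩
  · have := key 0 0 0 0 ν σ
    simp at this
    refine cancel (c := 3) (by norm_num) ?_
    rw [← this]
    module
  -- The three terms coincide and each carries the weight 1/2 of one mixed index pair, whence 3/2.
  · have := key 0 0 0 1 ν σ
    simp at this
    refine cancel (c := 3 / 2) (by norm_num) ?_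
    rw [← this]
    module
  · have := key 1 1 1 0 ν σ
    simp at this
    refine cancel (c := 3 / 2) (by norm_num) ?_
    rw [← this]
    module
  · have := key 1 1 1 1 ν σ
    simp at this
    refine cancel (c := 3) (by norm_num) ?_
    rw [← this]
    module
  · have := key 0 0 1 1 ν σ
    simp at this
    rw [← sub_eq_zero, ← this]
    module

/-- The jet coordinates extended by zero to the next order. -/
def zeroLift {r : ℕ} (z : JetCoords m r) : JetCoords m (r + 1) :=
  (z.1, fun k l σ => if h : (k : ℕ) < r + 1 then z.2 ⟨k, h⟩ l σ else 0)

theorem proj_zeroLift {r : ℕ} (z : JetCoords m r) : proj (zeroLift z) = z := by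
  refine Prod.ext rfl ?_
  funext k l σ
  simp only [proj, zeroLift, Fin.val_castSucc, k.isLt, dite_true]

theorem formalVec_zeroLift {r : ℕ} (i : Fin 2) (z : JetCoords m r) :
    formalVec i (zeroLift z) = cutVec i z := by
  refine Prod.ext rfl ?_
  funext k l σ
  by_cases h : (k : ℕ) < r <;> simp [formalVec, zeroLift, cutVec, h]

/-- Where the fourth-order coordinates are zero, the formal derivative of a third-order function is
its cut derivative. Triviality is needed only at these points. -/
theorem eulerLagrange_zeroLift (hF : IsPullback F L) (σ : Fin m) {z : JetCoords m 3}
    (hz : z ∈ jetDomain T 3) :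
    eulerLagrange L σ (zeroLift z) =
      (dVert 0 0 σ F - (dCut 0 (momentum F 0 σ) + dCut 1 (momentum F 1 σ))).1 z := by
  have hd (i : Fin 2) {f : JetCoords m 3 → ℝ} {a : smoothFn (jetDomain T 3)}
      (ha : Set.EqOn a f (jetDomain T 3)) : formalD i f (zeroLift z) = (dCut i a).1 z := by
    rw [formalD, proj_zeroLift, formalVec_zeroLift, dCut, der_apply ha hz, cutVec_eq_affineField]
  have hdd (i j : Fin 2) : formalD i (formalD j (dY2 i j σ L)) (zeroLift z) =
      (dCut i (dCut j ((if i = j then (1 : ℝ) else 1 / 2) • dVert 2 (i + j : ℕ) σ F))).1 z :=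
    hd i fun w hw => (hF.dY2 i j σ).cut_apply j hw
  simp only [eulerLagrange, hdd, proj_zeroLift, ← (hF.dY σ).2 z hz,
    ← (hF.dY1 _ σ).cut_apply _ hz, Fin.sum_univ_two]
  simp [momentum_zero, momentum_one]
  ring

theorem trivialRelations_of_eulerLagrange (hF : IsPullback F L)
    (h : ∀ z ∈ jetDomain T 2, OrderConditionAt L z)
    (hE : ∀ z ∈ jetDomain T 4, ∀ σ, eulerLagrange L σ z = 0) : TrivialRelations F where
  toOrderRelations := orderRelations_of_orderConditionAt hF h
  euler σ := by
    rw [← sub_eq_zero]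
    ext z hz
    rw [← eulerLagrange_zeroLift hF σ hz]
    exact hE _ (by simpa [jetDomain, zeroLift] using hz) σ

/-- Cut and formal derivatives agree here because their arguments are of first order. For P this
uses triviality, through `vert_two_skew`; for Q the order condition is enough. -/
theorem fundP_proj (hF : IsPullback F L) (h : TrivialRelations F) (σ ν : Fin m)
    {z : JetCoords m 3} (hz : z ∈ jetDomain T 3) :
    fundP L σ ν (proj z) = (lepageP F σ ν).1 z := by
  have h1 := ((hF.dY2 0 1 σ).dY1 0 ν).sub ((hF.dY2 0 1 ν).dY1 0 σ)
  have h2 := ((hF.dY2 0 1 ν).dY1 1 σ).sub ((hF.dY2 0 1 σ).dY1 1 ν)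
  have s (j : Fin 2) (l : ℕ) (ρ σ ν : Fin m) : dVert 2 l ρ
      (dVert 1 j σ ((if (0 : Fin 2) = 1 then (1 : ℝ) else 1 / 2) •
          dVert 2 ((0 : Fin 2) + (1 : Fin 2) : ℕ) ν F)
        - dVert 1 j ν ((if (0 : Fin 2) = 1 then (1 : ℝ) else 1 / 2) •
          dVert 2 ((0 : Fin 2) + (1 : Fin 2) : ℕ) σ F)) = 0 := by
    have h0 : dVert 2 l ρ (dVert 1 j σ (dVert 2 ((0 : Fin 2) + (1 : Fin 2) : ℕ) ν F)) =
        dVert 2 l ρ (dVert 1 j ν (dVert 2 ((0 : Fin 2) + (1 : Fin 2) : ℕ) σ F)) :=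
      sub_eq_zero.1 ((map_sub _ _ _).symm.trans (h.vert_two_skew j l ρ σ ν))
    rw [map_sub, map_smul, map_smul, map_smul, map_smul, h0, sub_self]
  have h1' := (h1.cut (fun l ρ => s 0 l ρ ν σ) 0).2 z hz
  have h2' := (h2.cut (fun l ρ => s 1 l ρ σ ν) 1).2 z hz
  rw [fundP, ← h1', ← h2', ← ((hF.dY1 1 ν).dY1 0 σ).2 z hz, ← ((hF.dY1 1 σ).dY1 0 ν).2 z hz]
  simp [lepageP]
  ring

theorem fundQ_proj (hF : IsPullback F L) (h : OrderRelations F) (j : Fin 2) (σ ν : Fin m)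
    {z : JetCoords m 3} (hz : z ∈ jetDomain T 3) :
    fundQ L j σ ν (proj z) = (lepageQ F j σ ν).1 z := by
  have s (l : ℕ) (ρ : Fin m) : dVert 2 l ρ ((if (0 : Fin 2) = 1 then (1 : ℝ) else 1 / 2) •
      dVert 2 ((0 : Fin 2) + (1 : Fin 2) : ℕ) σ
        ((if (0 : Fin 2) = 1 then (1 : ℝ) else 1 / 2) •
          dVert 2 ((0 : Fin 2) + (1 : Fin 2) : ℕ) ν F)) = 0 := by
    rw [map_smul, map_smul, map_smul]
    have := h.vert_two_hessian l ρ σ ν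
    simp [this]
  have h0 := fun i => (((hF.dY2 0 1 ν).dY2 0 1 σ).cut s i).2 z hz
  simp only [fundQ, ← h0, ← ((hF.dY2 _ _ _).dY1 _ _).2 z hz]
  have hj : j = 0 ∨ j = 1 := by omega
  rcases hj with rfl | rfl
  · simp [lepageQ_zero]
  · simp [lepageQ_one]

theorem fundR_proj (hF : IsPullback F L) (i j : Fin 2) (σ ν : Fin m)
    {z : JetCoords m 3} (hz : z ∈ jetDomain T 3) :
    fundR L i j σ ν (proj z) = (lepageR F i j σ ν).1 z := by
  simp only [fundR, lepageR, ← ((hF.dY2 _ _ _).dY2 _ _ _).2 z hz]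
  have hi : i = 0 ∨ i = 1 := by omega
  have hj : j = 0 ∨ j = 1 := by omega
  rcases hi with rfl | rfl <;> rcases hj with rfl | rfl <;> simp

theorem admissible_fundCoeffs (hF : IsPullback F L) :
    (fundCoeffs L).Admissible (jetDomain T 3) := by
  have pull {f : JetCoords m 2 → ℝ} (hf : ContDiffOn ℝ ∞ f (jetDomain T 2)) :
      ContDiffOn ℝ ∞ (fun z => f (proj z)) (jetDomain T 3) :=
    hf.comp projL.contDiff.contDiffOn fun _ h => h
  have cut {f : JetCoords m 2 → ℝ} (hf : ContDiffOn ℝ ∞ f (jetDomain T 2)) (i : Fin 2) :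
      ContDiffOn ℝ ∞ (cutD i f) (jetDomain T 2) := by
    refine contDiffOn_fderiv_apply (jetDomain T 2).isOpen hf ?_
    simp only [funext (cutVec_eq_affineField i)]
    exact (contDiff_affineField _ _).contDiffOn
  have d11 (i j σ ν) := ((hF.dY1 j ν).dY1 i σ).1
  have d12 (k i j σ ν) := ((hF.dY2 i j ν).dY1 k σ).1
  have d22 (p q i j σ ν) := ((hF.dY2 i j ν).dY2 p q σ).1
  refine ⟨fun σ ν => pull (f := fundP L σ ν) ?_,
    fun j σ ν => pull (f := fundQ L j σ ν) ?_, fun i j σ ν => ?_, fun σ ν z hz => ?_,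
    fun i j σ ν z hz => ?_⟩
  · exact ((contDiffOn_const.mul ((d11 _ _ _ _).sub (d11 _ _ _ _))).add
      (cut ((d12 _ _ _ _ _).sub (d12 _ _ _ _ _)) 0)).add
      (cut ((d12 _ _ _ _ _).sub (d12 _ _ _ _ _)) 1)
  · unfold fundQ
    split_ifs
    · exact (((contDiffOn_const.mul (d12 _ _ _ _ _)).sub (d12 _ _ _ _ _)).sub (d12 _ _ _ _ _)).sub
        (contDiffOn_const.mul (cut (d22 _ _ _ _ _ _) 1))
    · exact (((contDiffOn_const.mul (d12 _ _ _ _ _)).add (d12 _ _ _ _ _)).add (d12 _ _ _ _ _)).add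
        (contDiffOn_const.mul (cut (d22 _ _ _ _ _ _) 0))
  · exact (lepageR F i j σ ν).2.1.congr fun z hz => fundR_proj hF i j σ ν hz
  · have neg (i : Fin 2) (f g : JetCoords m 2 → ℝ) (w : JetCoords m 2) :
        cutD i (fun w => f w - g w) w = -cutD i (fun w => g w - f w) w := by
      have : (fun w => f w - g w) = fun w => -(g w - f w) := by
        funext w
        ring
      rw [cutD, cutD, this, fderiv_fun_neg]
      rfl
    simp only [fundCoeffs, fundP]
    rw [neg 0, neg 1]
    ring
  · simp only [fundCoeffs]
    rw [fundR_proj hF i j σ ν hz, fundR_proj hF j i ν σ hz]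
    have hi : i = 0 ∨ i = 1 := by omega
    have hj : j = 0 ∨ j = 1 := by omega
    rcases hi with rfl | rfl <;> rcases hj with rfl | rfl <;>
      simp [lepageR, dVert_comm 2 1 2 1 ν σ]

/-- The form with the coefficients of the fundamental form is closed if the Lagrangian is
trivial. -/
theorem extDeriv_ansatz_eq_zero (hF : IsPullback F L) (h : TrivialRelations F) {K : Coeffs m}
    (hK : K.Admissible (jetDomain T 3)) (hKL : K.EqOn (fundCoeffs L) (jetDomain T 3))
    {z : JetCoords m 3} (hz : z ∈ jetDomain T 3) : extDeriv (ansatz L K) z = 0 :=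
  h.extDeriv_eq_zero (formTable_ansatz hF hK
    (fun z hz σ ν => ((hKL z hz).1 σ ν).trans (fundP_proj hF h σ ν hz))
    (fun z hz j σ ν =>
      ((hKL z hz).2.1 j σ ν).trans (fundQ_proj hF h.toOrderRelations j σ ν hz))
    (fun z hz i j σ ν => ((hKL z hz).2.2 i j σ ν).trans (fundR_proj hF i j σ ν hz))) hz

/-- The coefficients of the ansatz are determined by its exterior derivative. -/
theorem coeffs_eqOn_of_extDeriv_eq (hF : IsPullback F L) {K K' : Coeffs m}
    (hK : K.Admissible (jetDomain T 3)) (hK' : K'.Admissible (jetDomain T 3))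
    (hd : ∀ z ∈ jetDomain T 3, extDeriv (ansatz L K) z = extDeriv (ansatz L K') z) :
    K.EqOn K' (jetDomain T 3) := by
  have t := formTable_ansatz_restr hF hK
  have t' := formTable_ansatz_restr hF hK'
  set η : JetCoords m 3 → JetCoords m 3 [⋀^Fin 2]→L[ℝ] ℝ :=
    fun z => ansatz L K z + (-1 : ℝ) • ansatz L K' z with hη
  have ev (z v) : η z v = ansatz L K z v - ansatz L K' z v := by
    simp [hη, sub_eq_add_neg]
  have hdiff : ∀ z ∈ jetDomain T 3, DifferentiableAt ℝ η z := fun z hz =>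
    (t.differentiableAt hz).add ((t'.differentiableAt hz).fun_const_smul _)
  have hclosed : ∀ z ∈ jetDomain T 3, extDeriv η z = 0 := fun z hz => by
    have h1 := extDeriv_add (t.differentiableAt hz) ((t'.differentiableAt hz).const_smul (-1 : ℝ))
    rw [extDeriv_smul, hd z hz] at h1
    refine Eq.trans h1 ?_
    module
  -- The values on pairs containing E_0 are the same for both forms, as they depend on L only.
  have hE : ∀ z ∈ jetDomain T 3, ∀ v, η z ![cutVec 0 z, v] = 0 := fun z hz v => by
    refine form_two_eq_zero_of_frame z _ _ (fun i => ?_) (fun k l σ => ?_) v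
    · have hi : i = 0 ∨ i = 1 := by omega
      rcases hi with rfl | rfl
      · have := form_two_swap (η z) (cutVec 0 z) (cutVec 0 z)
        linarith
      · rw [ev, t.base z hz, t'.base z hz, sub_self]
    · rw [ev, t.mixed z hz, t'.mixed z hz, sub_self]
  have key {z : JetCoords m 3} (hz : z ∈ jetDomain T 3) (k l : ℕ) (σ : Fin m) (k' l' : ℕ)
      (ν : Fin m) := form_two_vert_eq_zero_of_closed hdiff hclosed hE
    (fun z hz l σ v => by rw [ev, t.vert_three_left hz, t'.vert_three_left hz, sub_self])
    hz k l σ (coordVec k' l' ν)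
  simp only [ev] at key
  refine fun z hz => ⟨fun σ ν => ?_, fun j σ ν => ?_, fun i j σ ν => ?_⟩
  · have := key hz 0 0 σ 0 0 ν
    rw [t.vert z hz, t'.vert z hz, sub_eq_zero] at this
    simpa [vertTable, restr_apply _ hz] using this
  · have := key hz 0 0 σ 1 j ν
    rw [t.vert z hz, t'.vert z hz, sub_eq_zero] at this
    have hj : j = 0 ∨ j = 1 := by omega
    rcases hj with rfl | rfl <;> simpa [vertTable, restr_apply _ hz] using this
  · have := key hz 1 i σ 1 j ν
    rw [t.vert z hz, t'.vert z hz, sub_eq_zero] at this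
    have hi : i = 0 ∨ i = 1 := by omega
    have hj : j = 0 ∨ j = 1 := by omega
    rcases hi with rfl | rfl <;> rcases hj with rfl | rfl <;>
      simpa [vertTable, restr_apply _ hz] using this

end Fundamental

end FundLepage

end

open scoped Manifold ContDiff
open FundLepage
theorem theorem4 {m : ℕ} {X Y : Type*}
    [TopologicalSpace X] [ChartedSpace (EuclideanSpace ℝ (Fin 2)) X] [IsManifold (𝓡 2) ∞ X]
    [TopologicalSpace Y] [ChartedSpace (EuclideanSpace ℝ (Fin (2 + m))) Y]
    [IsManifold (𝓡 (2 + m)) ∞ Y]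
    (π : Y → X) (hπ : IsFibered (m := m) π)
    (lam : Lagrangian m π) (hlam : lam.OrderReducible)
    (c : FiberedChart (m := m) π) (L : JetCoords m 2 → ℝ) (hL : lam.IsLagrangeFunction c L) :
    (fundCoeffs L).Admissible (c.domain 3) ∧
      ∀ K : Coeffs m, K.Admissible (c.domain 3) → lam.IsTrivial →
        (c.IsClosedForm (ansatz L K) ↔ K.EqOn (fundCoeffs L) (c.domain 3)) := by
  obtain ⟨F, hF⟩ := exists_isPullback (T := ⟨c.ψ.target, c.ψ.open_target⟩) (f := L) hL.1
  have hadm := admissible_fundCoeffs hF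
  refine ⟨hadm, fun K hK htriv => ?_⟩
  have h := trivialRelations_of_eulerLagrange hF (hlam c L hL) (htriv c L hL)
  constructor
  · intro hclosed
    -- The form with coefficients (∗) is itself closed, so both exterior derivatives are zero and
    -- uniqueness applies.
    refine coeffs_eqOn_of_extDeriv_eq hF hK hadm fun z hz => ?_
    rw [hclosed z hz,
      extDeriv_ansatz_eq_zero hF h hadm (fun _ _ => ⟨fun _ _ => rfl, fun _ _ _ => rfl,
        fun _ _ _ _ => rfl⟩) hz]
  · exact fun hKL z hz => extDeriv_ansatz_eq_zero hF h hK hKL hz
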